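/- Let $(X,g)$ be a complete smooth Riemannian manifold without boundary, possibly non-compact, and let $\omega$ be a smooth closed 1-form on $X$. Let $\mathrm{grad}(\omega)$ be the vector field with $g(\mathrm{grad}(\omega),v)=\omega(v)$ for all tangent vectors $v$. Define $\mathrm{cat}(X,\omega)\in\{0,1,2,\dots\}\cup\{\infty\}$ as the smallest integer $k\ge 0$ with the following property ($\infty$ if there is none): for every positive integer $N$ there is an open cover $X=U\cup U_1\cup\dots\cup U_k$ such that each $U_i$ is null-homotopic in $X$ (its inclusion into $X$ is homotopic to a constant map), and there is a smooth homotopy $h:U\times[0,1]\to X$ such that $h_0$ is the inclusion and $\int_{\gamma_x}\omega\le -N$ for every $x\in U$, where $\gamma_x(t)=h(x,t)$. Suppose that 1. the number of zeros of $\omega$ is (finite and) less than $\mathrm{cat}(X,\omega)$; 2. the vector field $\mathrm{grad}(\omega)$ is complete (all its maximal integral curves are defined on $\mathbb R$), and there are a constant $c>0$ and a compact neighbourhood $K$ of the set of zeros of $\omega$ such that $|\mathrm{grad}(\omega)|\ge c$ on $X\setminus K$. Then the gradient flow of $\omega$, i.e. the flow of $-\mathrm{grad}(\omega)$, has at least one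 homoclinic cycle: there are $m\ge 1$ and non-constant trajectories $\gamma_1,\dots,\gamma_m:\mathbb R\to X$ of this flow, each converging to a zero of $\omega$ as $t\to+\infty$ and as $t\to-\infty$, such that $$\lim_{t\to\infty}\gamma_i(t)=\lim_{t\to-\infty}\gamma_{i+1}(t)\quad(1\le i\le m-1),\qquad \lim_{t\to\infty}\gamma_m(t)=\lim_{t\to-\infty}\gamma_1(t).$$ -/

import Mathlib

open scoped Manifold ContDiff Bundle Topology

noncomputable section

/-! Throughout, manifolds are smooth manifolds without boundary, modelled on a finite-dimensional
real vector space `E`, and a `1`-form is a family `α x : T_x X → ℝ` of covectors. -/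

/-- `α` is a smooth `1`-form, i.e. a `C^∞` section of the cotangent bundle. -/
def IsSmoothOneForm {E : Type*} [NormedAddCommGroup E] [NormedSpace ℝ E]
    {X : Type*} [TopologicalSpace X] [ChartedSpace E X] [IsManifold 𝓘(ℝ, E) ∞ X]
    (α : (x : X) → (TangentSpace 𝓘(ℝ, E) x →L[ℝ] ℝ)) : Prop :=
  ContMDiff 𝓘(ℝ, E) (𝓘(ℝ, E).prod 𝓘(ℝ, E →L[ℝ] ℝ)) ∞
    (fun x ↦ (Bundle.TotalSpace.mk' (E →L[ℝ] ℝ) x (α x) :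
      Bundle.TotalSpace (E →L[ℝ] ℝ)
        (fun x : X ↦ TangentSpace 𝓘(ℝ, E) x →L[ℝ] Bundle.Trivial X ℝ x)))

/-- The `1`-form `α` written in the preferred chart at `x₀`: the pullback of `α` under the
inverse of the chart, a `1`-form on an open subset of `E`. -/
def oneFormInChart {E : Type*} [NormedAddCommGroup E] [NormedSpace ℝ E]
    {X : Type*} [TopologicalSpace X] [ChartedSpace E X]
    (α : (x : X) → (TangentSpace 𝓘(ℝ, E) x →L[ℝ] ℝ)) (x₀ : X) (y : E) : E →L[ℝ] ℝ :=
  (α ((chartAt E x₀).symm y)).comp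
    (mfderiv 𝓘(ℝ, E) 𝓘(ℝ, E) (chartAt E x₀).symm y)

/-- `α` is a closed smooth `1`-form: it is smooth, and `dα = 0`, i.e. in every chart
`∂α_j/∂y_i = ∂α_i/∂y_j`. -/
structure IsClosedOneForm {E : Type*} [NormedAddCommGroup E] [NormedSpace ℝ E]
    {X : Type*} [TopologicalSpace X] [ChartedSpace E X] [IsManifold 𝓘(ℝ, E) ∞ X]
    (α : (x : X) → (TangentSpace 𝓘(ℝ, E) x →L[ℝ] ℝ)) : Prop where
  smooth : IsSmoothOneForm α
  closed : ∀ x₀ : X, ∀ y ∈ (chartAt E x₀).target, ∀ v w : E,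
    fderiv ℝ (oneFormInChart α x₀) y v w = fderiv ℝ (oneFormInChart α x₀) y w v

/-- The set of zeros of a `1`-form. -/
def zerosOfForm {E : Type*} [NormedAddCommGroup E] [NormedSpace ℝ E]
    {X : Type*} [TopologicalSpace X] [ChartedSpace E X]
    (α : (x : X) → (TangentSpace 𝓘(ℝ, E) x →L[ℝ] ℝ)) : Set X :=
  {x | α x = 0}

/-- The line integral `∫_γ α = ∫₀¹ α(γ'(t)) dt` of a `1`-form along a path `γ : [0,1] → X`. -/
def lineIntegral {E : Type*} [NormedAddCommGroup E] [NormedSpace ℝ E]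
    {X : Type*} [TopologicalSpace X] [ChartedSpace E X]
    (α : (x : X) → (TangentSpace 𝓘(ℝ, E) x →L[ℝ] ℝ)) (γ : ℝ → X) : ℝ :=
  ∫ t in (0 : ℝ)..1, α (γ t)
    (mfderivWithin 𝓘(ℝ, ℝ) 𝓘(ℝ, E) γ (Set.Icc 0 1) t (1 : ℝ))

/-- There is a smooth homotopy `h : U × [0,1] → X` starting at the inclusion `U → X` such that
`∫_{γ_x} α ≤ -N` for all `x ∈ U`, where `γ_x` is the path `t ↦ h (x, t)`. -/
def MovesBelow {E : Type*} [NormedAddCommGroup E] [NormedSpace ℝ E]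
    {X : Type*} [TopologicalSpace X] [ChartedSpace E X]
    (α : (x : X) → (TangentSpace 𝓘(ℝ, E) x →L[ℝ] ℝ)) (U : Set X) (N : ℕ) : Prop :=
  ∃ h : X × ℝ → X,
    ContMDiffOn (𝓘(ℝ, E).prod 𝓘(ℝ, ℝ)) 𝓘(ℝ, E) ∞ h (U ×ˢ Set.Icc (0 : ℝ) 1) ∧
    (∀ x ∈ U, h (x, 0) = x) ∧
    ∀ x ∈ U, lineIntegral α (fun t ↦ h (x, t)) ≤ -(N : ℝ)

/-- A subset of `X` is null-homotopic in `X` if its inclusion into `X` is homotopic to a constant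
map. -/
def NullhomotopicIn {X : Type*} [TopologicalSpace X] (U : Set X) : Prop :=
  (⟨Subtype.val, continuous_subtype_val⟩ : C(U, X)).Nullhomotopic

/-- For every positive integer `N` there is an open cover `X = U ∪ U₁ ∪ ⋯ ∪ U_k` with every `U_i`
null-homotopic in `X`, and a homotopy of `U` in `X` along which `α` integrates to at most `-N`. -/
def HasCategoricalCovers {E : Type*} [NormedAddCommGroup E] [NormedSpace ℝ E]
    {X : Type*} [TopologicalSpace X] [ChartedSpace E X]
    (α : (x : X) → (TangentSpace 𝓘(ℝ, E) x →L[ℝ] ℝ)) (k : ℕ) : Prop :=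
  ∀ N : ℕ, 0 < N → ∃ (U : Set X) (V : Fin k → Set X),
    IsOpen U ∧ (∀ i, IsOpen (V i)) ∧ U ∪ ⋃ i, V i = Set.univ ∧
    (∀ i, NullhomotopicIn (V i)) ∧ MovesBelow α U N

/-- The Lusternik-Schnirelmann category `cat(X, α)`: the least `k` for which `X` has categorical
covers as above for all `N`, and `∞` if there is no such `k`. -/
def lsCat {E : Type*} [NormedAddCommGroup E] [NormedSpace ℝ E]
    {X : Type*} [TopologicalSpace X] [ChartedSpace E X]
    (α : (x : X) → (TangentSpace 𝓘(ℝ, E) x →L[ℝ] ℝ)) : ℕ∞ :=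
  ⨅ (k : ℕ) (_ : HasCategoricalCovers α k), (k : ℕ∞)

/-- The gradient of a `1`-form with respect to the Riemannian metric: the vector field dual
to `α`. -/
def formGrad {E : Type*} [NormedAddCommGroup E] [NormedSpace ℝ E] [FiniteDimensional ℝ E]
    {X : Type*} [TopologicalSpace X] [ChartedSpace E X]
    [Bundle.RiemannianBundle (fun x : X ↦ TangentSpace 𝓘(ℝ, E) x)]
    (α : (x : X) → (TangentSpace 𝓘(ℝ, E) x →L[ℝ] ℝ)) (x : X) : TangentSpace 𝓘(ℝ, E) x :=
  haveI : FiniteDimensional ℝ (TangentSpace 𝓘(ℝ, E) x) := inferInstanceAs (FiniteDimensional ℝ E)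
  haveI : CompleteSpace (TangentSpace 𝓘(ℝ, E) x) := FiniteDimensional.complete ℝ _
  (InnerProductSpace.toDual ℝ (TangentSpace 𝓘(ℝ, E) x)).symm (α x)

theorem inner_formGrad {E : Type*} [NormedAddCommGroup E] [NormedSpace ℝ E]
    [FiniteDimensional ℝ E] {X : Type*} [TopologicalSpace X] [ChartedSpace E X]
    [Bundle.RiemannianBundle (fun x : X ↦ TangentSpace 𝓘(ℝ, E) x)]
    (α : (x : X) → (TangentSpace 𝓘(ℝ, E) x →L[ℝ] ℝ)) (x : X) (v : TangentSpace 𝓘(ℝ, E) x) :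
    inner ℝ (formGrad α x) v = α x v := by
  have : FiniteDimensional ℝ (TangentSpace 𝓘(ℝ, E) x) := inferInstanceAs (FiniteDimensional ℝ E)
  have : CompleteSpace (TangentSpace 𝓘(ℝ, E) x) := FiniteDimensional.complete ℝ _
  exact InnerProductSpace.toDual_symm_apply

/-- A vector field is complete if through every point there passes an integral curve that is
defined for all times. -/
def IsCompleteVectorField {E : Type*} [NormedAddCommGroup E] [NormedSpace ℝ E]
    {X : Type*} [TopologicalSpace X] [ChartedSpace E X]
    (v : (x : X) → TangentSpace 𝓘(ℝ, E) x) : Prop :=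
  ∀ x : X, ∃ γ : ℝ → X, γ 0 = x ∧ IsMIntegralCurve (I := 𝓘(ℝ, E)) γ v

/-- The flow of the vector field `v` has a homoclinic cycle: finitely many (at least one)
nonconstant trajectories `γ₀, …, γ_m` and fixed points `p₀, …, p_m` such that `γ_i` goes from `p_i`
at time `-∞` to `p_{i+1}` at time `+∞`, where the indices are cyclic
(addition in `Fin (m + 1)` is modulo `m + 1`). -/
def HasHomoclinicCycle {E : Type*} [NormedAddCommGroup E] [NormedSpace ℝ E]
    {X : Type*} [TopologicalSpace X] [ChartedSpace E X]
    (v : (x : X) → TangentSpace 𝓘(ℝ, E) x) : Prop :=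
  ∃ (m : ℕ) (p : Fin (m + 1) → X) (γ : Fin (m + 1) → ℝ → X),
    (∀ i, v (p i) = 0) ∧
    ∀ i, IsMIntegralCurve (I := 𝓘(ℝ, E)) (γ i) v ∧
      (∃ s t, γ i s ≠ γ i t) ∧
      Filter.Tendsto (γ i) Filter.atBot (𝓝 (p i)) ∧
      Filter.Tendsto (γ i) Filter.atTop (𝓝 (p (i + 1)))

end

/-!
Let `ψ` be the flow of `-grad α` and let `L x t = ∫₀ᵗ |grad α|² (ψ_s x) ds`, so that moving `x`
along the flow for the time `t` decreases the integral of `α` by `L x t`. If there is no homoclinic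
cycle, then `X` has, for every `N`, a categorical cover with one null-homotopic set for each zero of
`α` (`hasCategoricalCovers_of_forall_not_transGen`), so that `cat(X, α)` is at most the number of
zeros.

The set moved by a homotopy is `U = {x | L x t > N for some t ≥ 0}`. On it, `α` integrates to `-N`
along the trajectories up to the time `T x` with `L x (T x) = N`, and `T` is smooth by the implicit
function theorem (`DissipativeFlow.exists_contMDiffOn_time`). This needs `ψ` and `L` to be smooth in
the starting point and the time (`contMDiff_flow_integral`); near time `0` this is the implicit
function theorem for the integral equation in a Banach space of curves
(`exists_contDiffAt_solution`), and the group law does the rest.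

A point outside `U` dissipates energy at most `N`. Since `|grad α|` is bounded below away from the
zeros, its trajectory converges to a zero `p` (`DissipativeFlow.exists_tendsto_atTop`). The main
point is that a neighbourhood `W` of `p` can be chosen such that a trajectory that leaves `W` and
returns to it while dissipating energy at most `N + 1` stays near `p` in between
(`DissipativeFlow.exists_nhds_forall_mem`): a sequence of counterexamples with `W` shrinking to `p`
would accumulate at a nonconstant trajectory from `p` to some zero, from which one continues to
arrive near `p`; repeating the argument at that zero, the finiteness of the set of zeros yields
a cycle of connections (`DissipativeFlow.exists_connects_of_exit`). Consequently all times between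
two visits to `W` are times at which the trajectory is in a null-homotopic neighbourhood of `p`.
A partition of unity gives a continuous choice of such times, which deforms the set of points that
visit `W` with energy below `N + 1` into that neighbourhood
(`DissipativeFlow.exists_nullhomotopic_open`).
-/

noncomputable section

universe u w

/-! ### Superposition operators on spaces of continuous maps -/

section Superposition

variable {K : Type w} [TopologicalSpace K] [CompactSpace K] {F G H : Type u}
  [NormedAddCommGroup F] [NormedSpace ℝ F] [NormedAddCommGroup G] [NormedSpace ℝ G]
  [NormedAddCommGroup H] [NormedSpace ℝ H]

/-- The bounded bilinear map between spaces of continuous maps which a bounded bilinear map `B`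
induces pointwise. -/
def pointwiseBilinear (K : Type w) [TopologicalSpace K] [CompactSpace K] (B : H →L[ℝ] F →L[ℝ] G) :
    C(K, H) →L[ℝ] C(K, F) →L[ℝ] C(K, G) :=
  LinearMap.mkContinuous₂
    (LinearMap.mk₂ ℝ
      (fun (A : C(K, H)) (γ : C(K, F)) ↦
        (⟨fun t ↦ B (A t) (γ t),
          (B.continuous.comp A.continuous).clm_apply γ.continuous⟩ : C(K, G)))
      (fun _ _ _ ↦ by ext; simp) (fun _ _ _ ↦ by ext; simp)
      (fun _ _ _ ↦ by ext; simp) (fun _ _ _ ↦ by ext; simp)) ‖B‖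
    (fun A γ ↦ by
      refine (ContinuousMap.norm_le _ (by positivity)).2 fun t ↦ ?_
      refine (B.le_opNorm₂ (A t) (γ t)).trans ?_
      gcongr
      · exact A.norm_coe_le_norm t
      · exact γ.norm_coe_le_norm t)

theorem pointwiseBilinear_apply (B : H →L[ℝ] F →L[ℝ] G) (A : C(K, H)) (γ : C(K, F)) (t : K) :
    pointwiseBilinear K B A γ t = B (A t) (γ t) := rfl

/-- The derivative of the superposition operator is pointwise multiplication with the derivative.
The remainder is small uniformly on `K` because `β ↦ f' ∘ β` is continuous for the sup norm. -/
theorem hasFDerivAt_postcomp (B : H →L[ℝ] F →L[ℝ] G) (f : C(F, G)) (f' : C(F, H))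
    (hf : ∀ x, HasFDerivAt f (B (f' x)) x) (γ : C(K, F)) :
    HasFDerivAt (fun β : C(K, F) ↦ f.comp β) (pointwiseBilinear K B (f'.comp γ)) γ := by
  rw [hasFDerivAt_iff_isLittleO_nhds_zero, Asymptotics.isLittleO_iff]
  intro ε hε
  have hcont : ContinuousAt (fun β : C(K, F) ↦ f'.comp β) γ :=
    (ContinuousMap.continuous_postcomp f').continuousAt
  have hη : 0 < ε / (‖B‖ + 1) := by positivity
  obtain ⟨δ, hδ, hball⟩ := Metric.continuousAt_iff.1 hcont _ hη
  filter_upwards [Metric.ball_mem_nhds (0 : C(K, F)) hδ] with h hh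
  rw [mem_ball_zero_iff] at hh
  refine (ContinuousMap.norm_le _ (by positivity)).2 fun t ↦ ?_
  have key := (convex_segment (γ t) (γ t + h t)).norm_image_sub_le_of_norm_hasFDerivWithin_le'
    (f := f) (f' := fun x ↦ B (f' x)) (φ := B (f' (γ t))) (C := ε)
    (fun z _ ↦ (hf z).hasFDerivWithinAt) (fun z hz ↦ by
      rw [segment_eq_image'] at hz
      obtain ⟨s, hs, rfl⟩ := hz
      have h1 : dist (γ + s • h) γ < δ := by
        rw [dist_eq_norm, add_sub_cancel_left, norm_smul, Real.norm_of_nonneg hs.1]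
        nlinarith [norm_nonneg h, hs.1, hs.2]
      have h2 := hball h1
      rw [dist_eq_norm] at h2
      have h3 := (ContinuousMap.norm_coe_le_norm (f'.comp (γ + s • h) - f'.comp γ) t).trans h2.le
      have h5 : ‖f' (γ t + s • h t) - f' (γ t)‖ ≤ ε / (‖B‖ + 1) := by simpa using h3
      have h6 : ‖B (f' (γ t + s • h t) - f' (γ t))‖ ≤ ε := by
        refine (B.le_opNorm _).trans ?_
        calc ‖B‖ * ‖f' (γ t + s • h t) - f' (γ t)‖ ≤ (‖B‖ + 1) * (ε / (‖B‖ + 1)) := by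
              gcongr; linarith
          _ = ε := by field_simp
      simpa using h6)
    (left_mem_segment ℝ _ _) (right_mem_segment ℝ _ _)
  simp only [add_sub_cancel_left] at key
  have h4 : ε * ‖h t‖ ≤ ε * ‖h‖ := by gcongr; exact h.norm_coe_le_norm t
  simpa [pointwiseBilinear_apply] using key.trans h4

/-- The superposition operator `β ↦ f ∘ β` of a smooth map `f` is a smooth map between Banach
spaces of continuous maps. -/
theorem contDiff_postcomp (f : C(F, G)) (hf : ContDiff ℝ ∞ f) :
    ContDiff ℝ ∞ (fun β : C(K, F) ↦ f.comp β) := by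
  rw [contDiff_infty]
  intro n
  induction n generalizing G with
  | zero => exact contDiff_zero.2 (ContinuousMap.continuous_postcomp f)
  | succ n ih =>
    have hf' : ContDiff ℝ ∞ (fderiv ℝ f) := hf.fderiv_right (m := ∞) (by simp)
    let f' : C(F, F →L[ℝ] G) := ⟨fderiv ℝ f, hf'.continuous⟩
    have hd : ∀ x, HasFDerivAt f (ContinuousLinearMap.id ℝ (F →L[ℝ] G) (f' x)) x := fun x ↦
      (hf.differentiable (by simp) x).hasFDerivAt
    push_cast
    rw [contDiff_succ_iff_hasFDerivAt]
    refine ⟨fun β ↦ pointwiseBilinear K (ContinuousLinearMap.id ℝ (F →L[ℝ] G)) (f'.comp β), ?_,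
      fun β ↦ hasFDerivAt_postcomp _ f f' hd β⟩
    exact (pointwiseBilinear K (ContinuousLinearMap.id ℝ (F →L[ℝ] G))).contDiff.comp (ih f' hf')

end Superposition

/-! ### Smooth dependence of solutions of differential equations on the initial value -/

/-- The compact time interval on which rescaled solutions are considered. It is a neighbourhood
of `[0, 1]`, so that solutions on it are differentiable on a neighbourhood of `[0, 1]`. -/
abbrev TimeInterval : Type := Set.Icc (-2 : ℝ) 2

/-- A continuous curve on the time interval, extended by constants to the real line. -/
def extendCurve {F : Type u} [NormedAddCommGroup F] (γ : C(TimeInterval, F)) (r : ℝ) : F :=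
  γ (Set.projIcc (-2 : ℝ) 2 (by norm_num) r)

theorem continuous_extendCurve {F : Type u} [NormedAddCommGroup F] (γ : C(TimeInterval, F)) :
    Continuous (extendCurve γ) :=
  γ.continuous.comp continuous_projIcc

theorem norm_extendCurve_le {F : Type u} [NormedAddCommGroup F] (γ : C(TimeInterval, F)) (r : ℝ) :
    ‖extendCurve γ r‖ ≤ ‖γ‖ :=
  γ.norm_coe_le_norm _

/-- The bounded operator `γ ↦ (s ↦ ∫₀ˢ γ)`. -/
def primitiveL (F : Type u) [NormedAddCommGroup F] [NormedSpace ℝ F] [CompleteSpace F] :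
    C(TimeInterval, F) →L[ℝ] C(TimeInterval, F) :=
  LinearMap.mkContinuous
    { toFun := fun γ ↦ ⟨fun s ↦ ∫ r in (0 : ℝ)..s, extendCurve γ r,
        (intervalIntegral.continuous_primitive
          (fun _ _ ↦ (continuous_extendCurve γ).intervalIntegrable _ _) 0).comp
          continuous_subtype_val⟩
      map_add' := fun γ β ↦ by
        ext s
        exact intervalIntegral.integral_add ((continuous_extendCurve γ).intervalIntegrable _ _)
          ((continuous_extendCurve β).intervalIntegrable _ _)
      map_smul' := fun c γ ↦ by
        ext s
        exact intervalIntegral.integral_smul c (extendCurve γ) } 2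
    (fun γ ↦ by
      refine (ContinuousMap.norm_le _ (by positivity)).2 fun s ↦ ?_
      have h := intervalIntegral.norm_integral_le_of_norm_le_const (a := (0 : ℝ)) (b := s)
        (f := extendCurve γ) (C := ‖γ‖) (fun r _ ↦ norm_extendCurve_le γ r)
      have hs : |(s : ℝ) - 0| ≤ 2 := by
        rw [sub_zero, abs_le]; exact s.2
      calc _ ≤ ‖γ‖ * |(s : ℝ) - 0| := h
        _ ≤ ‖γ‖ * 2 := by gcongr
        _ = 2 * ‖γ‖ := mul_comm _ _)

/-- For a smooth vector field `v`, the solution of `γ' = t v(γ)`, `γ(0) = x` on a fixed time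
interval depends smoothly on `(x, t)` near `(y, 0)`, as an element of the Banach space of continuous
curves. This is the implicit function theorem for the integral equation. -/
theorem exists_contDiffAt_solution {F : Type u} [NormedAddCommGroup F] [NormedSpace ℝ F]
    [CompleteSpace F] (v : C(F, F)) (hv : ContDiff ℝ ∞ v) (y : F) :
    ∃ Γ : F × ℝ → C(TimeInterval, F), ContDiffAt ℝ ∞ Γ (y, 0) ∧
      Γ (y, 0) = ContinuousMap.const _ y ∧
      ∀ᶠ p in 𝓝 (y, (0 : ℝ)),
        Γ p = ContinuousMap.const _ p.1 + p.2 • primitiveL F (v.comp (Γ p)) := by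
  let cst : F →L[ℝ] C(TimeInterval, F) := ContinuousLinearMap.const ℝ TimeInterval
  have hcst : ∀ x, cst x = ContinuousMap.const _ x := fun x ↦ rfl
  let Ψ : (F × ℝ) × C(TimeInterval, F) → C(TimeInterval, F) := fun q ↦
    q.2 - cst q.1.1 - q.1.2 • primitiveL F (v.comp q.2)
  have hΨ : ContDiff ℝ ∞ Ψ := by
    have h1 : ContDiff ℝ ∞ (fun q : (F × ℝ) × C(TimeInterval, F) ↦
        primitiveL F (v.comp q.2)) :=
      (primitiveL F).contDiff.comp ((contDiff_postcomp v hv).comp contDiff_snd)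
    have h2 : ContDiff ℝ ∞ (fun q : (F × ℝ) × C(TimeInterval, F) ↦ cst q.1.1) :=
      cst.contDiff.comp (contDiff_fst.comp contDiff_fst)
    have h3 : ContDiff ℝ ∞ (fun q : (F × ℝ) × C(TimeInterval, F) ↦ q.1.2) :=
      contDiff_snd.comp contDiff_fst
    exact (contDiff_snd.sub h2).sub (h3.smul h1)
  let p₀ : (F × ℝ) × C(TimeInterval, F) := ((y, 0), cst y)
  have hΨ₀ : Ψ p₀ = 0 := by simp [Ψ, p₀]
  have hinv : (fderiv ℝ Ψ p₀ ∘L .inr ℝ (F × ℝ) C(TimeInterval, F)) =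
      ContinuousLinearMap.id ℝ _ := by
    have h1 : HasFDerivAt (fun β ↦ Ψ (p₀.1, β))
        (fderiv ℝ Ψ p₀ ∘L .inr ℝ (F × ℝ) C(TimeInterval, F)) p₀.2 :=
      HasFDerivAt.comp (g := Ψ) p₀.2 (hΨ.differentiable (by simp) p₀).hasFDerivAt
        (hasFDerivAt_prodMk_right p₀.1 p₀.2)
    have h2 : HasFDerivAt (fun β ↦ Ψ (p₀.1, β)) (ContinuousLinearMap.id ℝ _) p₀.2 := by
      have : (fun β ↦ Ψ (p₀.1, β)) = fun β ↦ β - cst y := by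
        funext β; simp [Ψ, p₀]
      rw [this]
      exact (hasFDerivAt_id _).sub_const _
    exact h1.unique h2
  have hI : (fderiv ℝ Ψ p₀ ∘L .inr ℝ (F × ℝ) C(TimeInterval, F)).IsInvertible := by
    rw [hinv]; exact ⟨ContinuousLinearEquiv.refl ℝ _, rfl⟩
  have hne : (∞ : WithTop ℕ∞) ≠ 0 := by simp
  refine ⟨hΨ.contDiffAt.implicitFunction hne hI, hΨ.contDiffAt.contDiffAt_implicitFunction hne hI,
    hΨ.contDiffAt.implicitFunction_apply_self hne hI, ?_⟩
  filter_upwards [hΨ.contDiffAt.eventually_apply_implicitFunction hne hI] with p hp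
  rw [hΨ₀] at hp
  have hp' := sub_eq_zero.1 hp
  rw [sub_eq_iff_eq_add] at hp'
  rw [← hcst, add_comm]
  exact hp'

section IntegralEquation

variable {F : Type u} [NormedAddCommGroup F] [NormedSpace ℝ F] [CompleteSpace F] {v : C(F, F)}
  {x : F} {t : ℝ} {β : C(TimeInterval, F)}

theorem extendCurve_eq_of_integralEquation
    (h : β = ContinuousMap.const _ x + t • primitiveL F (v.comp β)) {s : ℝ}
    (hs : s ∈ Set.Icc (-2 : ℝ) 2) :
    extendCurve β s = x + t • ∫ r in (0 : ℝ)..s, v (extendCurve β r) := by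
  have h1 : extendCurve β s = β ⟨s, hs⟩ := by rw [extendCurve, Set.projIcc_of_mem _ hs]
  rw [h1]
  exact DFunLike.congr_fun h ⟨s, hs⟩

theorem hasDerivAt_extendCurve_of_integralEquation
    (h : β = ContinuousMap.const _ x + t • primitiveL F (v.comp β)) {s : ℝ}
    (hs : s ∈ Set.Ioo (-2 : ℝ) 2) :
    HasDerivAt (extendCurve β) (t • v (extendCurve β s)) s := by
  have hc : Continuous fun r ↦ v (extendCurve β r) := v.continuous.comp (continuous_extendCurve β)
  have h1 : HasDerivAt (fun s ↦ x + t • ∫ r in (0 : ℝ)..s, v (extendCurve β r))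
      (t • v (extendCurve β s)) s :=
    ((intervalIntegral.integral_hasDerivAt_right (hc.intervalIntegrable _ _)
      hc.aestronglyMeasurable.stronglyMeasurableAtFilter hc.continuousAt).const_smul t).const_add x
  refine h1.congr_of_eventuallyEq ?_
  filter_upwards [Ioo_mem_nhds hs.1 hs.2] with r hr
  exact extendCurve_eq_of_integralEquation h (Set.Ioo_subset_Icc_self hr)

end IntegralEquation

/-! ### Smoothness of the flow of a complete vector field -/

/-- A smooth map defined near a point agrees near that point with a globally smooth map. -/
theorem ContDiffOn.exists_contDiff_eventuallyEq {E F : Type*} [NormedAddCommGroup E]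
    [NormedSpace ℝ E] [FiniteDimensional ℝ E] [NormedAddCommGroup F] [NormedSpace ℝ F]
    {f : E → F} {s : Set E} (hf : ContDiffOn ℝ ∞ f s) (hs : IsOpen s) {c : E} (hc : c ∈ s) :
    ∃ g : E → F, ContDiff ℝ ∞ g ∧ g =ᶠ[𝓝 c] f := by
  obtain ⟨r, hr, hrs⟩ := Metric.isOpen_iff.1 hs c hc
  let χ : ContDiffBump c := ⟨r / 4, r / 2, by positivity, by linarith⟩
  refine ⟨fun x ↦ χ x • f x, ?_, ?_⟩
  · refine contDiff_iff_contDiffAt.2 fun x ↦ ?_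
    by_cases hx : x ∈ tsupport χ
    · rw [χ.tsupport_eq] at hx
      have hx' : x ∈ s :=
        hrs (Metric.closedBall_subset_ball (by change r / 2 < r; linarith) hx)
      exact χ.contDiffAt.smul (hf.contDiffAt (hs.mem_nhds hx'))
    · have h0 : (fun x ↦ χ x • f x) =ᶠ[𝓝 x] fun _ ↦ 0 := by
        filter_upwards [notMem_tsupport_iff_eventuallyEq.1 hx] with z hz
        rw [hz]; simp
      exact contDiffAt_const.congr_of_eventuallyEq h0
  · filter_upwards [χ.eventuallyEq_one] with x hx
    rw [hx]; simp

section Flow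

variable {E : Type u} [NormedAddCommGroup E] [NormedSpace ℝ E]
  {X : Type w} [TopologicalSpace X] [ChartedSpace E X] [IsManifold 𝓘(ℝ, E) ∞ X]

/-- The vector field `v` in the preferred chart at `y`. -/
def fieldInChart (v : (x : X) → TangentSpace 𝓘(ℝ, E) x) (y : X) (z : E) : E :=
  tangentCoordChange 𝓘(ℝ, E) ((extChartAt 𝓘(ℝ, E) y).symm z) y ((extChartAt 𝓘(ℝ, E) y).symm z)
    (v ((extChartAt 𝓘(ℝ, E) y).symm z))

theorem contDiffOn_fieldInChart {v : (x : X) → TangentSpace 𝓘(ℝ, E) x}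
    (hv : ContMDiff 𝓘(ℝ, E) 𝓘(ℝ, E).tangent ∞ (fun x ↦ (⟨x, v x⟩ : TangentBundle 𝓘(ℝ, E) X)))
    (y : X) : ContDiffOn ℝ ∞ (fieldInChart v y) (extChartAt 𝓘(ℝ, E) y).target := by
  rw [← contMDiffOn_iff_contDiffOn]
  have h1 : ContMDiffOn 𝓘(ℝ, E) 𝓘(ℝ, E) ∞
      (fun x ↦ (trivializationAt E (TangentSpace 𝓘(ℝ, E)) y ⟨x, v x⟩).2)
      (trivializationAt E (TangentSpace 𝓘(ℝ, E)) y).baseSet :=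
    (Bundle.Trivialization.contMDiffOn_section_baseSet_iff
      (trivializationAt E (TangentSpace 𝓘(ℝ, E)) y)).1 hv.contMDiffOn
  have h2 := h1.comp (contMDiffOn_extChartAt_symm (I := 𝓘(ℝ, E)) (n := ∞) y) (fun z hz ↦ by
    have := (extChartAt 𝓘(ℝ, E) y).map_target hz
    rw [extChartAt_source] at this
    simpa using this)
  exact h2

theorem hasMFDerivAt_extChartAt_symm_comp (v : (x : X) → TangentSpace 𝓘(ℝ, E) x) (y : X)
    {z : ℝ → E} {t c : ℝ} (hz : HasDerivAt z (c • fieldInChart v y (z t)) t)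
    (ht : z t ∈ (extChartAt 𝓘(ℝ, E) y).target) :
    HasMFDerivAt 𝓘(ℝ, ℝ) 𝓘(ℝ, E) ((extChartAt 𝓘(ℝ, E) y).symm ∘ z) t
      ((1 : ℝ →L[ℝ] ℝ).smulRight ((c • v) ((extChartAt 𝓘(ℝ, E) y).symm (z t)))) := by
  obtain ⟨x, hx⟩ : ∃ x, x = (extChartAt 𝓘(ℝ, E) y).symm (z t) := ⟨_, rfl⟩
  have hs : x ∈ (extChartAt 𝓘(ℝ, E) y).source := hx ▸ (extChartAt 𝓘(ℝ, E) y).map_target ht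
  have hs2 := mem_extChartAt_source (I := 𝓘(ℝ, E)) x
  have hzx : extChartAt 𝓘(ℝ, E) y x = z t := hx ▸ (extChartAt 𝓘(ℝ, E) y).right_inv ht
  have hself : ∀ w : E, tangentCoordChange 𝓘(ℝ, E) y x x
      (c • tangentCoordChange 𝓘(ℝ, E) x y x w) = c • w := fun w ↦ by
    rw [map_smul, tangentCoordChange_comp ⟨⟨hs2, hs⟩, hs2⟩, tangentCoordChange_self hs2]
  have h3 : HasFDerivAt (extChartAt 𝓘(ℝ, E) x ∘ (extChartAt 𝓘(ℝ, E) y).symm)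
      (tangentCoordChange 𝓘(ℝ, E) y x x) (z t) := by
    have h4 := hasFDerivWithinAt_tangentCoordChange (I := 𝓘(ℝ, E)) ⟨hs, hs2⟩
    rw [hzx] at h4
    rwa [ModelWithCorners.range_eq_univ, hasFDerivWithinAt_univ] at h4
  rw [fieldInChart, ← hx] at hz
  rw [← hx]
  have h5 := (h3.comp_hasDerivAt t hz).hasFDerivAt
  have h6 := hself (v x)
  rw [h6] at h5
  refine ⟨(continuousAt_extChartAt_symm'' ht).comp hz.continuousAt, ?_⟩
  rw [← ContinuousLinearMap.smulRight_one_eq_toSpanSingleton] at h5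
  have h7 := h5.hasFDerivWithinAt (s := Set.range 𝓘(ℝ, ℝ))
  rw [hx] at h7 ⊢
  exact h7

/-- Near time `0` the flow of a smooth vector field `v`, and the integrals of a smooth function `f`
along its trajectories, are smooth. In a chart, the pair of the trajectory and the integral
solves the differential equation with right-hand side `(v, f)`. -/
theorem contMDiffAt_flow_integral_zero [FiniteDimensional ℝ E] [T2Space X]
    {v : (x : X) → TangentSpace 𝓘(ℝ, E) x}
    (hv : ContMDiff 𝓘(ℝ, E) 𝓘(ℝ, E).tangent ∞ (fun x ↦ (⟨x, v x⟩ : TangentBundle 𝓘(ℝ, E) X)))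
    {f : X → ℝ} (hf : ContMDiff 𝓘(ℝ, E) 𝓘(ℝ, ℝ) ∞ f) {ψ : X → ℝ → X} (h0 : ∀ x, ψ x 0 = x)
    (hψ : ∀ x, IsMIntegralCurve (I := 𝓘(ℝ, E)) (ψ x) v) (y : X) :
    ContMDiffAt (𝓘(ℝ, E).prod 𝓘(ℝ, ℝ)) 𝓘(ℝ, E) ∞ (fun p : X × ℝ ↦ ψ p.1 p.2) (y, 0) ∧
    ContMDiffAt (𝓘(ℝ, E).prod 𝓘(ℝ, ℝ)) 𝓘(ℝ, ℝ) ∞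
      (fun p : X × ℝ ↦ ∫ s in (0 : ℝ)..p.2, f (ψ p.1 s)) (y, 0) := by
  have : IsManifold 𝓘(ℝ, E) 1 X := IsManifold.of_le (n := ∞) (by simp)
  have hv1 : ContMDiff 𝓘(ℝ, E) 𝓘(ℝ, E).tangent 1
      (fun x ↦ (⟨x, v x⟩ : TangentBundle 𝓘(ℝ, E) X)) := hv.of_le (by simp)
  let e := extChartAt 𝓘(ℝ, E) y
  have htarget : IsOpen e.target := isOpen_extChartAt_target y
  have hc : e y ∈ e.target := mem_extChartAt_target y
  have hfe : ContDiffOn ℝ ∞ (fun z ↦ f (e.symm z)) e.target := by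
    rw [← contMDiffOn_iff_contDiffOn]
    exact hf.comp_contMDiffOn (contMDiffOn_extChartAt_symm y)
  obtain ⟨g, hg, hgU⟩ := ((contDiffOn_fieldInChart hv y).prodMk hfe).exists_contDiff_eventuallyEq
    htarget hc
  let V : C(E × ℝ, E × ℝ) := ⟨fun q ↦ g q.1, hg.continuous.comp continuous_fst⟩
  have hV : ContDiff ℝ ∞ V := hg.comp contDiff_fst
  obtain ⟨Γ, hΓ, hΓ0, hΓe⟩ := exists_contDiffAt_solution V hV (e y, (0 : ℝ))
  obtain ⟨r, hr, hball⟩ := Metric.eventually_nhds_iff.1 (hgU.and (htarget.mem_nhds hc))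
  let q : X × ℝ → (E × ℝ) × ℝ := fun p ↦ ((e p.1, 0), p.2)
  have hq : ContMDiffAt (𝓘(ℝ, E).prod 𝓘(ℝ, ℝ)) 𝓘(ℝ, (E × ℝ) × ℝ) ∞ q (y, 0) := by
    have h1 : ContMDiffAt (𝓘(ℝ, E).prod 𝓘(ℝ, ℝ)) 𝓘(ℝ, E) ∞ (fun p : X × ℝ ↦ e p.1) (y, 0) :=
      ContMDiffAt.comp (y, (0 : ℝ)) (contMDiffAt_extChartAt (x := y)) contMDiffAt_fst
    exact (h1.prodMk_space contMDiffAt_const).prodMk_space contMDiffAt_snd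
  have hq0 : q (y, 0) = ((e y, 0), 0) := rfl
  have hqΓ : ContMDiffAt (𝓘(ℝ, E).prod 𝓘(ℝ, ℝ)) 𝓘(ℝ, C(TimeInterval, E × ℝ)) ∞
      (fun p ↦ Γ (q p)) (y, 0) :=
    ContMDiffAt.comp (y, (0 : ℝ)) (g := Γ) (by rw [hq0]; exact hΓ.contMDiffAt) hq
  let one : TimeInterval := ⟨1, by norm_num, by norm_num⟩
  have hqΓ1 : ContMDiffAt (𝓘(ℝ, E).prod 𝓘(ℝ, ℝ)) 𝓘(ℝ, E × ℝ) ∞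
      (fun p ↦ Γ (q p) one) (y, 0) :=
    ContMDiffAt.comp (y, (0 : ℝ))
      (ContinuousMap.evalCLM ℝ one : C(TimeInterval, E × ℝ) →L[ℝ] E × ℝ).contMDiff.contMDiffAt hqΓ
  have key : ∀ᶠ p : X × ℝ in 𝓝 (y, 0), ψ p.1 p.2 = e.symm (Γ (q p) one).1 ∧
      ∫ s in (0 : ℝ)..p.2, f (ψ p.1 s) = (Γ (q p) one).2 := by
    have e1 : ∀ᶠ p in 𝓝 (y, (0 : ℝ)), dist (Γ (q p)) (ContinuousMap.const _ (e y, 0)) < r := by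
      have h1 := hqΓ.continuousAt (Metric.ball_mem_nhds _ hr)
      rw [hq0, hΓ0] at h1
      exact h1
    have e2 := hq.continuousAt.eventually (hq0 ▸ hΓe)
    have e3 : ∀ᶠ p in 𝓝 (y, (0 : ℝ)), p.1 ∈ e.source :=
      continuousAt_fst.eventually (extChartAt_source_mem_nhds (I := 𝓘(ℝ, E)) y)
    filter_upwards [e1, e2, e3] with p h1 h2 h3
    obtain ⟨x, t⟩ := p
    set β := Γ (q (x, t)) with hβ
    change β = ContinuousMap.const _ (e x, 0) + t • primitiveL (E × ℝ) (V.comp β) at h2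
    let z : ℝ → E := fun s ↦ (extendCurve β s).1
    have hz : ∀ s, g (z s) = (fieldInChart v y (z s), f (e.symm (z s))) ∧ z s ∈ e.target := by
      intro s
      refine hball ?_
      have h4 := (ContinuousMap.dist_apply_le_dist (f := β) (g := ContinuousMap.const _ (e y, 0))
        (Set.projIcc (-2 : ℝ) 2 (by norm_num) s)).trans_lt h1
      exact (le_max_left _ _).trans_lt h4
    have hz0 : z 0 = e x := by
      have := extendCurve_eq_of_integralEquation h2 (s := 0) (by norm_num)
      simp [z, this]
    have hcurve : IsMIntegralCurveOn (I := 𝓘(ℝ, E)) (e.symm ∘ z) (t • v) (Set.Ioo (-2) 2) := by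
      intro s hs
      have h5 := hasDerivAt_extendCurve_of_integralEquation h2 hs
      have h6 : HasDerivAt z (t • fieldInChart v y (z s)) s := by
        have h7 := h5.fst
        have h8 : (V (extendCurve β s)).1 = fieldInChart v y (z s) := congrArg Prod.fst (hz s).1
        rw [← h8]
        exact h7
      exact (hasMFDerivAt_extChartAt_symm_comp v y h6 (hz s).2).hasMFDerivWithinAt
    have htv : ContMDiff 𝓘(ℝ, E) 𝓘(ℝ, E).tangent 1
        (fun x ↦ (⟨x, (t • v) x⟩ : TangentBundle 𝓘(ℝ, E) X)) :=
      ContMDiff.const_smul_section hv1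
    have heq : Set.EqOn (e.symm ∘ z) (ψ x ∘ (· * t)) (Set.Ioo (-2) 2) :=
      isMIntegralCurveOn_Ioo_eqOn_of_contMDiff_boundaryless (t₀ := 0) (by norm_num) htv hcurve
        (((hψ x).comp_mul t).isMIntegralCurveOn _) (by
          simp only [Function.comp_apply, hz0, zero_mul, h0]
          exact e.left_inv h3)
    have hβ1 : β one = extendCurve β 1 := by
      rw [extendCurve, Set.projIcc_of_mem _ one.2]
    constructor
    · have := heq (x := 1) (by norm_num)
      simp only [Function.comp_apply, one_mul] at this
      rw [hβ1, ← this]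
    · rw [hβ1, extendCurve_eq_of_integralEquation h2 (by norm_num)]
      have hcV : Continuous fun r ↦ V (extendCurve β r) :=
        V.continuous.comp (continuous_extendCurve β)
      have h9 := (ContinuousLinearMap.snd ℝ E ℝ).intervalIntegral_comp_comm
        (hcV.intervalIntegrable (μ := MeasureTheory.volume) 0 1)
      have h10 : ∫ r in (0 : ℝ)..1, (V (extendCurve β r)).2 =
          ∫ r in (0 : ℝ)..1, f (ψ x (r * t)) := by
        refine intervalIntegral.integral_congr fun r hr ↦ ?_
        rw [Set.uIcc_of_le zero_le_one] at hr
        have h11 := heq (x := r) ⟨by linarith [hr.1], by linarith [hr.2]⟩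
        have h12 : (V (extendCurve β r)).2 = f (e.symm (z r)) := congrArg Prod.snd (hz r).1
        change (V (extendCurve β r)).2 = f (ψ x (r * t))
        rw [h12]
        exact congrArg f h11
      have h13 := intervalIntegral.mul_integral_comp_mul_right (a := 0) (b := 1)
        (f := fun s ↦ f (ψ x s)) t
      rw [zero_mul, one_mul] at h13
      rw [← h13, ← h10]
      simp only [Prod.snd_add, Prod.smul_snd, smul_eq_mul, zero_add]
      congr 1
  constructor
  · have h1 : ContMDiffAt (𝓘(ℝ, E).prod 𝓘(ℝ, ℝ)) 𝓘(ℝ, E) ∞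
        (fun p ↦ e.symm (Γ (q p) one).1) (y, 0) := by
      have h2 : (Γ (q (y, 0)) one).1 = e y := by rw [hq0, hΓ0]; rfl
      refine ContMDiffAt.comp (y, (0 : ℝ)) (g := e.symm) (I' := 𝓘(ℝ, E)) ?_
        ((ContinuousLinearMap.fst ℝ E ℝ).contMDiff.contMDiffAt.comp (y, (0 : ℝ)) hqΓ1)
      rw [h2]
      exact (contMDiffOn_extChartAt_symm y).contMDiffAt (htarget.mem_nhds hc)
    exact h1.congr_of_eventuallyEq (key.mono fun p hp ↦ hp.1)
  · have h1 := (ContinuousLinearMap.snd ℝ E ℝ).contMDiff.contMDiffAt.comp (n := ∞)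
      (y, (0 : ℝ)) hqΓ1
    exact h1.congr_of_eventuallyEq (key.mono fun p hp ↦ hp.2)

/-- The group law of the flow of a complete vector field. -/
theorem integralCurve_add [T2Space X] {v : (x : X) → TangentSpace 𝓘(ℝ, E) x}
    (hv : ContMDiff 𝓘(ℝ, E) 𝓘(ℝ, E).tangent ∞ (fun x ↦ (⟨x, v x⟩ : TangentBundle 𝓘(ℝ, E) X)))
    {ψ : X → ℝ → X} (h0 : ∀ x, ψ x 0 = x)
    (hψ : ∀ x, IsMIntegralCurve (I := 𝓘(ℝ, E)) (ψ x) v) (x : X) (s t : ℝ) :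
    ψ (ψ x s) t = ψ x (s + t) := by
  have : IsManifold 𝓘(ℝ, E) 1 X := IsManifold.of_le (n := ∞) (by simp)
  have h := isMIntegralCurve_Ioo_eq_of_contMDiff_boundaryless (t₀ := 0) (hv.of_le (by simp))
    (hψ (ψ x s)) ((hψ x).comp_add s) (by simp [h0])
  rw [h, Function.comp_apply, add_comm]

/-- The flow of a complete smooth vector field, and the integrals of a smooth function along its
trajectories, are smooth in the starting point and the time. Smoothness near time `0` propagates
along a trajectory by the group law. -/
theorem contMDiff_flow_integral [FiniteDimensional ℝ E] [T2Space X]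
    {v : (x : X) → TangentSpace 𝓘(ℝ, E) x}
    (hv : ContMDiff 𝓘(ℝ, E) 𝓘(ℝ, E).tangent ∞ (fun x ↦ (⟨x, v x⟩ : TangentBundle 𝓘(ℝ, E) X)))
    {f : X → ℝ} (hf : ContMDiff 𝓘(ℝ, E) 𝓘(ℝ, ℝ) ∞ f) {ψ : X → ℝ → X} (h0 : ∀ x, ψ x 0 = x)
    (hψ : ∀ x, IsMIntegralCurve (I := 𝓘(ℝ, E)) (ψ x) v) :
    ContMDiff (𝓘(ℝ, E).prod 𝓘(ℝ, ℝ)) 𝓘(ℝ, E) ∞ (fun p : X × ℝ ↦ ψ p.1 p.2) ∧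
    ContMDiff (𝓘(ℝ, E).prod 𝓘(ℝ, ℝ)) 𝓘(ℝ, ℝ) ∞
      (fun p : X × ℝ ↦ ∫ s in (0 : ℝ)..p.2, f (ψ p.1 s)) := by
  have hadd := integralCurve_add hv h0 hψ
  have hint : ∀ x s t, ∫ r in (0 : ℝ)..(s + t), f (ψ x r) =
      (∫ r in (0 : ℝ)..s, f (ψ x r)) + ∫ r in (0 : ℝ)..t, f (ψ (ψ x s) r) := by
    intro x s t
    have hc : Continuous fun r ↦ f (ψ x r) := hf.continuous.comp (hψ x).continuous
    rw [← intervalIntegral.integral_add_adjacent_intervals (hc.intervalIntegrable 0 s)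
      (hc.intervalIntegrable s (s + t))]
    simp only [hadd]
    rw [intervalIntegral.integral_comp_add_left (fun r ↦ f (ψ x r)), add_zero]
  let I := 𝓘(ℝ, E).prod 𝓘(ℝ, ℝ)
  let L : X × ℝ → ℝ := fun p ↦ ∫ s in (0 : ℝ)..p.2, f (ψ p.1 s)
  let Ψ : X × ℝ → X := fun p ↦ ψ p.1 p.2
  -- Only for finite `n` is the set of points of `C^n` regularity open.
  suffices H : ∀ (n : ℕ) (p : X × ℝ), ContMDiffAt I 𝓘(ℝ, E) n Ψ p ∧ ContMDiffAt I 𝓘(ℝ, ℝ) n L p from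
    ⟨contMDiff_infty.2 fun n p ↦ (H n p).1, contMDiff_infty.2 fun n p ↦ (H n p).2⟩
  intro n
  let J : X × ℝ → Prop := fun p ↦ ContMDiffAt I 𝓘(ℝ, E) n Ψ p ∧ ContMDiffAt I 𝓘(ℝ, ℝ) n L p
  rintro ⟨x, t⟩
  have : IsManifold 𝓘(ℝ, E) n X := IsManifold.of_le (n := ∞) (by exact_mod_cast le_top)
  have hloc : ∀ t₀ : ℝ, ∀ᶠ q : ℝ × ℝ in 𝓝 (t₀, t₀), J (ψ x q.1, q.2 - q.1) := by
    intro t₀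
    have h1 := contMDiffAt_flow_integral_zero hv hf h0 hψ (ψ x t₀)
    have hn : (n : WithTop ℕ∞) ≠ ∞ := by exact_mod_cast ENat.natCast_ne_top n
    have h2 : ∀ᶠ p in 𝓝 (ψ x t₀, (0 : ℝ)), J p :=
      ((contMDiffAt_iff_contMDiffAt_nhds hn).1 (contMDiffAt_infty.1 h1.1 n)).and
        ((contMDiffAt_iff_contMDiffAt_nhds hn).1 (contMDiffAt_infty.1 h1.2 n))
    have hc : Continuous fun q : ℝ × ℝ ↦ (ψ x q.1, q.2 - q.1) :=
      ((hψ x).continuous.comp continuous_fst).prodMk (continuous_snd.sub continuous_fst)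
    have h3 := hc.tendsto (t₀, t₀)
    simp only [sub_self] at h3
    exact h3.eventually h2
  let A : Set ℝ := {t | ContMDiffAt 𝓘(ℝ, E) 𝓘(ℝ, E) n (fun z ↦ ψ z t) x ∧
    ContMDiffAt 𝓘(ℝ, E) 𝓘(ℝ, ℝ) n (fun z ↦ L (z, t)) x}
  have hstep : ∀ t s, t ∈ A → J (ψ x t, s - t) → J (x, s) := by
    rintro t s ⟨h1, h2⟩ ⟨h3, h4⟩
    have h5 : ContMDiffAt I I n (fun p : X × ℝ ↦ (ψ p.1 t, p.2 - t)) (x, s) := by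
      refine ContMDiffAt.prodMk ?_ ?_
      · exact ContMDiffAt.comp (x, s) (g := fun z ↦ ψ z t) h1 contMDiffAt_fst
      · exact contMDiffAt_snd.sub contMDiffAt_const
    constructor
    · have h6 := ContMDiffAt.comp (x, s) (g := Ψ) h3 h5
      refine h6.congr_of_eventuallyEq (Filter.Eventually.of_forall fun p ↦ ?_)
      simp [Ψ, hadd]
    · have h6 : ContMDiffAt I 𝓘(ℝ, ℝ) n
          (fun p : X × ℝ ↦ L (p.1, t) + L (ψ p.1 t, p.2 - t)) (x, s) :=
        (ContMDiffAt.comp (x, s) (g := fun z ↦ L (z, t)) h2 contMDiffAt_fst).add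
          (ContMDiffAt.comp (x, s) (g := L) h4 h5)
      refine h6.congr_of_eventuallyEq (Filter.Eventually.of_forall fun p ↦ ?_)
      have := hint p.1 t (p.2 - t)
      rw [add_sub_cancel] at this
      exact this
  have hJA : ∀ s, J (x, s) → s ∈ A := by
    rintro s ⟨h1, h2⟩
    have h3 : ContMDiffAt 𝓘(ℝ, E) I n (fun z : X ↦ (z, s)) x :=
      contMDiffAt_id.prodMk contMDiffAt_const
    exact ⟨ContMDiffAt.comp x (g := Ψ) h1 h3, ContMDiffAt.comp x (g := L) h2 h3⟩
  have hA : A = Set.univ := by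
    refine IsClopen.eq_univ ⟨isClosed_of_closure_subset fun t₀ ht₀ ↦ ?_,
      isOpen_iff_mem_nhds.2 fun t₀ ht₀ ↦ ?_⟩ ⟨0, ?_⟩
    · have h1 : ∀ᶠ s in 𝓝 t₀, J (ψ x s, t₀ - s) :=
        (Continuous.prodMk_left t₀).tendsto t₀ |>.eventually (hloc t₀)
      obtain ⟨s, hs, hsA⟩ := mem_closure_iff_nhds.1 ht₀ _ h1
      exact hJA _ (hstep s t₀ hsA hs)
    · have h1 : ∀ᶠ s in 𝓝 t₀, J (ψ x t₀, s - t₀) :=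
        (Continuous.prodMk_right t₀).tendsto t₀ |>.eventually (hloc t₀)
      filter_upwards [h1] with s hs
      exact hJA _ (hstep t₀ s ht₀ hs)
    · constructor
      · simp only [h0]; exact contMDiffAt_id
      · simp only [L, intervalIntegral.integral_same]; exact contMDiffAt_const
  have htA : t ∈ A := by rw [hA]; trivial
  refine hstep t t htA ?_
  exact (hloc t).self_of_nhds

end Flow

/-! ### Smoothness of the gradient -/

section Gradient

variable {E : Type u} [NormedAddCommGroup E] [NormedSpace ℝ E] [FiniteDimensional ℝ E]
  {X : Type w} [TopologicalSpace X] [ChartedSpace E X] [IsManifold 𝓘(ℝ, E) ∞ X]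
  [Bundle.RiemannianBundle (fun x : X ↦ TangentSpace 𝓘(ℝ, E) x)]

/-- An injective map from a finite-dimensional space to its dual is invertible. -/
theorem ContinuousLinearMap.isInvertible_of_injective_dual {G : E →L[ℝ] E →L[ℝ] ℝ}
    (hG : Function.Injective G) : G.IsInvertible := by
  have hrank : Module.finrank ℝ E = Module.finrank ℝ (E →L[ℝ] ℝ) := by
    rw [← (LinearMap.toContinuousLinearMap : (E →ₗ[ℝ] ℝ) ≃ₗ[ℝ] (E →L[ℝ] ℝ)).finrank_eq]
    exact (Subspace.dual_finrank_eq (K := ℝ) (V := E)).symm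
  refine ⟨(LinearMap.linearEquivOfInjective (G : E →ₗ[ℝ] E →L[ℝ] ℝ) hG
    hrank).toContinuousLinearEquiv, ?_⟩
  ext a b
  rfl

/-- The gradient of a smooth form with respect to a smooth metric is smooth. In a trivialization,
the gradient is obtained by applying the inverse of the matrix of the metric to the form. -/
theorem contMDiff_formGrad
    [IsContMDiffRiemannianBundle 𝓘(ℝ, E) ∞ E (fun x : X ↦ TangentSpace 𝓘(ℝ, E) x)]
    {α : (x : X) → (TangentSpace 𝓘(ℝ, E) x →L[ℝ] ℝ)} (hα : IsSmoothOneForm α) :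
    ContMDiff 𝓘(ℝ, E) 𝓘(ℝ, E).tangent ∞
      (fun x ↦ (⟨x, formGrad α x⟩ : TangentBundle 𝓘(ℝ, E) X)) := by
  obtain ⟨g, hg, hgi⟩ := IsContMDiffRiemannianBundle.exists_contMDiff (IB := 𝓘(ℝ, E)) (n := ∞)
    (F := E) (E := fun x : X ↦ TangentSpace 𝓘(ℝ, E) x)
  intro x₀
  have hα₀ := (Bundle.contMDiffAt_section x₀).1 (hα x₀)
  have hg₀ := (Bundle.contMDiffAt_section x₀).1 (hg x₀)
  simp only [hom_trivializationAt_apply] at hα₀ hg₀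
  refine (Bundle.contMDiffAt_section x₀).2 ?_
  let e := trivializationAt E (fun x : X ↦ TangentSpace 𝓘(ℝ, E) x) x₀
  let A : X → E →L[ℝ] ℝ := fun x ↦ ContinuousLinearMap.inCoordinates E
    (fun x : X ↦ TangentSpace 𝓘(ℝ, E) x) ℝ (Bundle.Trivial X ℝ) x₀ x x₀ x (α x)
  let G : X → E →L[ℝ] E →L[ℝ] ℝ := fun x ↦ ContinuousLinearMap.inCoordinates E
    (fun x : X ↦ TangentSpace 𝓘(ℝ, E) x) (E →L[ℝ] ℝ) (fun x : X ↦ TangentSpace 𝓘(ℝ, E) x →L[ℝ] ℝ)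
      x₀ x x₀ x (g x)
  have hA : ContMDiffAt 𝓘(ℝ, E) 𝓘(ℝ, E →L[ℝ] ℝ) ∞ A x₀ := hα₀
  have hG : ContMDiffAt 𝓘(ℝ, E) 𝓘(ℝ, E →L[ℝ] E →L[ℝ] ℝ) ∞ G x₀ := hg₀
  have hA' : ∀ x ∈ e.baseSet, ∀ a, A x a = α x (e.symm x a) := fun x hx a ↦ by
    simp only [A, ContinuousLinearMap.inCoordinates]
    refine Eq.trans ?_ (congrArg (α x) (Bundle.Trivialization.symmL_apply (R := ℝ) e hx a))
    simp [e]
  have hG' : ∀ x ∈ e.baseSet, ∀ a b, G x a b = g x (e.symm x a) (e.symm x b) := fun x hx a b ↦ by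
    simp only [G]
    rw [inCoordinates_apply_eq₂ hx hx (Set.mem_univ _)]
    simp [e]
  have hinv : ∀ x ∈ e.baseSet, (G x).IsInvertible := fun x hx ↦ by
    refine ContinuousLinearMap.isInvertible_of_injective_dual
      ((injective_iff_map_eq_zero (G x)).2 fun a ha ↦ ?_)
    have h1 : inner ℝ (e.symm x a) (e.symm x a) = 0 := by
      rw [hgi, ← hG' x hx, ha]; rfl
    have h2 : e.symm x a = 0 := inner_self_eq_zero.1 h1
    have h3 := e.apply_mk_symm hx a
    have h4 : e.symm x (0 : E) = 0 := by
      rw [← e.symmL_apply (R := ℝ) hx, map_zero]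
    rw [h2, ← h4, e.apply_mk_symm hx] at h3
    exact (congrArg Prod.snd h3).symm
  have hgrad : ∀ x ∈ e.baseSet, (e ⟨x, formGrad α x⟩).2 = (G x).inverse (A x) := fun x hx ↦ by
    have h1 : G x (e ⟨x, formGrad α x⟩).2 = A x := by
      ext b
      rw [hG' x hx, hA' x hx, e.symm_apply_apply_mk hx, ← hgi, inner_formGrad]
    obtain ⟨Φ, hΦ⟩ := hinv x hx
    rw [← h1, ← hΦ]
    simp
  have hsmooth : ContMDiffAt 𝓘(ℝ, E) 𝓘(ℝ, E) ∞ (fun x ↦ (G x).inverse (A x)) x₀ := by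
    obtain ⟨Φ, hΦ⟩ := hinv x₀ (FiberBundle.mem_baseSet_trivializationAt' x₀)
    have h1 : ContDiffAt ℝ ∞ ContinuousLinearMap.inverse (G x₀) := by
      rw [← hΦ]; exact contDiffAt_map_inverse Φ
    exact (ContMDiffAt.comp x₀ h1.contMDiffAt hG).clm_apply hA
  refine hsmooth.congr_of_eventuallyEq ?_
  filter_upwards [e.open_baseSet.mem_nhds (FiberBundle.mem_baseSet_trivializationAt' x₀)] with x hx
  exact hgrad x hx

end Gradient

/-! ### Flows that dissipate energy -/

open Filter Set

/-- A continuous flow `ψ` on `X`, together with the rate `|grad|²` at which it dissipates energy.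
The rate vanishes only at finitely many points, all of which are fixed by the flow, and is bounded
below by a positive constant outside a compact set. -/
structure DissipativeFlow (X : Type w) [TopologicalSpace X] where
  /-- The trajectory through a point. -/
  toFun : X → ℝ → X
  /-- The rate of dissipation. -/
  rate : X → ℝ
  continuous_toFun : Continuous fun p : X × ℝ ↦ toFun p.1 p.2
  map_zero : ∀ x, toFun x 0 = x
  map_add : ∀ x s t, toFun (toFun x s) t = toFun x (s + t)
  continuous_rate : Continuous rate
  rate_nonneg : ∀ x, 0 ≤ rate x
  finite_zeros : {x | rate x = 0}.Finite
  fixed : ∀ x t, rate x = 0 → toFun x t = x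
  bound : ∃ c > 0, ∃ K : Set X, IsCompact K ∧ ∀ x ∉ K, c ≤ rate x

namespace DissipativeFlow

variable {X : Type w} [TopologicalSpace X] (Φ : DissipativeFlow X)

/-- The rest points of the flow. -/
def zeros : Set X := {x | Φ.rate x = 0}

/-- The energy dissipated along the trajectory through `x` up to time `t`. -/
def energy (x : X) (t : ℝ) : ℝ := ∫ s in (0 : ℝ)..t, Φ.rate (Φ.toFun x s)

theorem continuous_trajectory (x : X) : Continuous (Φ.toFun x) :=
  Φ.continuous_toFun.comp (Continuous.prodMk_right x)

theorem continuous_rate_trajectory (x : X) : Continuous fun s ↦ Φ.rate (Φ.toFun x s) :=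
  Φ.continuous_rate.comp (Φ.continuous_trajectory x)

theorem intervalIntegrable_rate (x : X) (a b : ℝ) :
    IntervalIntegrable (fun s ↦ Φ.rate (Φ.toFun x s)) MeasureTheory.volume a b :=
  (Φ.continuous_rate_trajectory x).intervalIntegrable a b

@[simp] theorem energy_zero (x : X) : Φ.energy x 0 = 0 := intervalIntegral.integral_same

theorem energy_add (x : X) (s t : ℝ) :
    Φ.energy x (s + t) = Φ.energy x s + Φ.energy (Φ.toFun x s) t := by
  unfold energy
  rw [← intervalIntegral.integral_add_adjacent_intervals (Φ.intervalIntegrable_rate x 0 s)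
    (Φ.intervalIntegrable_rate x s (s + t))]
  simp only [Φ.map_add]
  rw [intervalIntegral.integral_comp_add_left (fun r ↦ Φ.rate (Φ.toFun x r)), add_zero]

theorem energy_sub (x : X) (s t : ℝ) :
    Φ.energy x t - Φ.energy x s = ∫ r in s..t, Φ.rate (Φ.toFun x r) :=
  intervalIntegral.integral_interval_sub_left (Φ.intervalIntegrable_rate x 0 t)
    (Φ.intervalIntegrable_rate x 0 s)

theorem energy_mono (x : X) : Monotone (Φ.energy x) := fun s t h ↦ by
  have h1 := Φ.energy_sub x s t
  have h2 : 0 ≤ ∫ r in s..t, Φ.rate (Φ.toFun x r) :=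
    intervalIntegral.integral_nonneg h fun r _ ↦ Φ.rate_nonneg _
  linarith

theorem continuous_energy :
    Continuous fun p : X × ℝ ↦ Φ.energy p.1 p.2 :=
  intervalIntegral.continuous_parametric_intervalIntegral_of_continuous
    (f := fun (p : X × ℝ) s ↦ Φ.rate (Φ.toFun p.1 s))
    (Φ.continuous_rate.comp (Φ.continuous_toFun.comp
      ((continuous_fst.comp continuous_fst).prodMk continuous_snd))) continuous_snd

theorem toFun_neg_toFun (x : X) (t : ℝ) : Φ.toFun (Φ.toFun x t) (-t) = x := by
  rw [Φ.map_add, add_neg_cancel, Φ.map_zero]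

/-- A trajectory that meets a rest point is constant. -/
theorem mem_zeros_of_toFun_mem {x : X} {t : ℝ} (h : Φ.toFun x t ∈ Φ.zeros) : x ∈ Φ.zeros := by
  have h1 := Φ.fixed _ (-t) h
  rw [toFun_neg_toFun] at h1
  rw [h1]; exact h

theorem isClosed_zeros : IsClosed Φ.zeros := isClosed_singleton.preimage Φ.continuous_rate

theorem isCompact_zeros : IsCompact Φ.zeros := Φ.finite_zeros.isCompact

/-- The flow run backwards. -/
def reverse : DissipativeFlow X where
  toFun x t := Φ.toFun x (-t)
  rate := Φ.rate
  continuous_toFun := Φ.continuous_toFun.comp (continuous_fst.prodMk continuous_snd.neg)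
  map_zero x := by rw [neg_zero, Φ.map_zero]
  map_add x s t := by rw [Φ.map_add, neg_add]
  continuous_rate := Φ.continuous_rate
  rate_nonneg := Φ.rate_nonneg
  finite_zeros := Φ.finite_zeros
  fixed x t h := Φ.fixed x _ h
  bound := Φ.bound

theorem energy_reverse (x : X) (t : ℝ) : Φ.reverse.energy x t = -Φ.energy x (-t) := by
  change ∫ s in (0 : ℝ)..t, Φ.rate (Φ.toFun x (-s)) = -∫ s in (0 : ℝ)..(-t), _
  rw [intervalIntegral.integral_comp_neg (fun s ↦ Φ.rate (Φ.toFun x s)), neg_zero,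
    intervalIntegral.integral_symm]

/-- The rate is bounded below outside every neighbourhood of the rest points. -/
theorem exists_le_rate {B : Set X} (hB : IsOpen B) (hZ : Φ.zeros ⊆ B) :
    ∃ c > 0, ∀ x ∉ B, c ≤ Φ.rate x := by
  obtain ⟨c, hc, K, hK, hcK⟩ := Φ.bound
  have hKB : IsCompact (K \ B) := hK.diff hB
  rcases (K \ B).eq_empty_or_nonempty with he | hne
  · exact ⟨c, hc, fun x hx ↦ hcK x fun hxK ↦ (he ▸ (⟨hxK, hx⟩ : x ∈ K \ B) : x ∈ (∅ : Set X))⟩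
  · obtain ⟨y, hy, hmin⟩ := hKB.exists_isMinOn hne Φ.continuous_rate.continuousOn
    have hy0 : 0 < Φ.rate y :=
      lt_of_le_of_ne (Φ.rate_nonneg y) fun h ↦ hy.2 (hZ h.symm)
    refine ⟨min c (Φ.rate y), lt_min hc hy0, fun x hx ↦ ?_⟩
    by_cases hxK : x ∈ K
    · exact (min_le_right _ _).trans (hmin ⟨hxK, hx⟩)
    · exact (min_le_left _ _).trans (hcK x hxK)

/-- A trajectory with bounded energy is eventually in any given neighbourhood of the rest points.
It spends only a short time outside a smaller neighbourhood `u`, and all points of `u` stay in the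
given neighbourhood for a certain time. -/
theorem eventually_mem_of_energy_le {x : X} {N : ℝ} (hx : ∀ t, 0 ≤ t → Φ.energy x t ≤ N)
    {B : Set X} (hB : IsOpen B) (hZ : Φ.zeros ⊆ B) : ∀ᶠ t in atTop, Φ.toFun x t ∈ B := by
  have hS : IsOpen {p : X × ℝ | Φ.toFun p.1 p.2 ∈ B} := hB.preimage Φ.continuous_toFun
  obtain ⟨u, v, hu, hv, hZu, h0v, huv⟩ := generalized_tube_lemma Φ.isCompact_zeros
    (isCompact_singleton (x := (0 : ℝ))) hS (by
      rintro ⟨z, s⟩ ⟨hz, hs⟩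
      have hs' : s = 0 := hs
      subst hs'
      change Φ.toFun z 0 ∈ B
      rw [Φ.map_zero]; exact hZ hz)
  obtain ⟨δ, hδ, hδv⟩ := Metric.isOpen_iff.1 hv 0 (h0v rfl)
  obtain ⟨c, hc, hcu⟩ := Φ.exists_le_rate hu hZu
  have hbdd : BddAbove (range (Φ.energy x)) := by
    refine ⟨N, ?_⟩
    rintro _ ⟨t, rfl⟩
    exact (Φ.energy_mono x (le_max_left t 0)).trans (hx _ (le_max_right t 0))
  have hlim := tendsto_atTop_ciSup (Φ.energy_mono x) hbdd
  have hdiff : Tendsto (fun t ↦ Φ.energy x t - Φ.energy x (t - δ / 2)) atTop (𝓝 0) := by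
    have h1 := hlim.sub (hlim.comp (tendsto_atTop_add_const_right atTop (-(δ / 2)) tendsto_id))
    simpa [sub_eq_add_neg] using h1
  filter_upwards [hdiff.eventually (gt_mem_nhds (by positivity : 0 < c * (δ / 2)))] with t ht
  -- On `[t - δ / 2, t]` the trajectory meets `u`, for otherwise too much energy is dissipated.
  obtain ⟨s, hs, hsu⟩ : ∃ s ∈ Icc (t - δ / 2) t, Φ.toFun x s ∈ u := by
    by_contra! hcon
    have h2 : ∫ _ in (t - δ / 2)..t, c ≤ ∫ r in (t - δ / 2)..t, Φ.rate (Φ.toFun x r) :=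
      intervalIntegral.integral_mono_on (by linarith) intervalIntegrable_const
        (Φ.intervalIntegrable_rate x _ _) fun r hr ↦ hcu _ (hcon r hr)
    rw [intervalIntegral.integral_const, ← Φ.energy_sub, smul_eq_mul] at h2
    linarith
  have h3 : Φ.toFun (Φ.toFun x s) (t - s) ∈ B :=
    huv (⟨hsu, hδv (by
      rw [Metric.mem_ball, Real.dist_eq, sub_zero, abs_lt]
      constructor <;> linarith [hs.1, hs.2])⟩ : (Φ.toFun x s, t - s) ∈ u ×ˢ v)
  rwa [Φ.map_add, add_sub_cancel] at h3

/-- A trajectory with bounded energy converges to a rest point. -/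
theorem exists_tendsto_atTop [T2Space X] {x : X} {N : ℝ} (hx : ∀ t, 0 ≤ t → Φ.energy x t ≤ N) :
    ∃ z ∈ Φ.zeros, Tendsto (Φ.toFun x) atTop (𝓝 z) := by
  obtain ⟨U, hU, hdisj⟩ := Φ.finite_zeros.t2_separation
  have h1 := Φ.eventually_mem_of_energy_le hx (B := ⋃ z ∈ Φ.zeros, U z)
    (isOpen_biUnion fun z _ ↦ (hU z).2) fun z hz ↦ mem_biUnion hz (hU z).1
  obtain ⟨T, hT⟩ := eventually_atTop.1 h1
  obtain ⟨z, hz, hTz⟩ := mem_iUnion₂.1 (hT T le_rfl)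
  have hothers : IsOpen (⋃ y ∈ Φ.zeros \ {z}, U y) := isOpen_biUnion fun y _ ↦ (hU y).2
  have hdis : Disjoint (U z) (⋃ y ∈ Φ.zeros \ {z}, U y) :=
    disjoint_iUnion₂_right.2 fun y hy ↦ hdisj hz hy.1 fun h ↦ hy.2 h.symm
  have hsplit : ∀ y ∈ ⋃ z ∈ Φ.zeros, U z, y ∈ U z ∪ ⋃ y ∈ Φ.zeros \ {z}, U y := by
    intro y hy
    obtain ⟨z', hz', hyz'⟩ := mem_iUnion₂.1 hy
    by_cases h : z' = z
    · exact Or.inl (h ▸ hyz')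
    · exact Or.inr (mem_biUnion (⟨hz', h⟩ : z' ∈ Φ.zeros \ {z}) hyz')
  have hstay : Φ.toFun x '' Ici T ⊆ U z := by
    refine IsPreconnected.subset_left_of_subset_union (hU z).2 hothers hdis ?_
      ⟨_, mem_image_of_mem _ self_mem_Ici, hTz⟩
      (isPreconnected_Ici.image _ (Φ.continuous_trajectory x).continuousOn)
    rintro _ ⟨t, ht, rfl⟩
    exact hsplit _ (hT t ht)
  refine ⟨z, hz, tendsto_nhds.2 fun W hW hzW ↦ ?_⟩
  have h2 := Φ.eventually_mem_of_energy_le hx (B := W ∪ ⋃ y ∈ Φ.zeros \ {z}, U y)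
    (hW.union hothers) fun y hy ↦ by
      by_cases h : y = z
      · exact Or.inl (h ▸ hzW)
      · exact Or.inr (mem_biUnion (⟨hy, h⟩ : y ∈ Φ.zeros \ {z}) (hU y).1)
  filter_upwards [h2, eventually_ge_atTop T] with t ht htT
  refine ht.resolve_right fun h ↦ ?_
  exact hdis.le_bot ⟨hstay (mem_image_of_mem _ htT), h⟩

theorem exists_tendsto_atBot [T2Space X] {x : X} {N : ℝ} (hx : ∀ t, 0 ≤ t → -Φ.energy x (-t) ≤ N) :
    ∃ z ∈ Φ.zeros, Tendsto (Φ.toFun x) atBot (𝓝 z) := by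
  obtain ⟨z, hz, h⟩ := Φ.reverse.exists_tendsto_atTop (x := x) (N := N)
    fun t ht ↦ (Φ.energy_reverse x t).trans_le (hx t ht)
  refine ⟨z, hz, ?_⟩
  have h1 := h.comp tendsto_neg_atBot_atTop
  refine h1.congr fun t ↦ ?_
  change Φ.toFun x (- -t) = _
  rw [neg_neg]

end DissipativeFlow

/-! ### Broken trajectories and homoclinic cycles -/

namespace DissipativeFlow

variable {X : Type w} [TopologicalSpace X] (Φ : DissipativeFlow X)

/-- There is a nonconstant trajectory from the rest point `p` to the rest point `q`. -/
def Connects (p q : X) : Prop :=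
  p ∈ Φ.zeros ∧ q ∈ Φ.zeros ∧ ∃ y ∉ Φ.zeros,
    Tendsto (Φ.toFun y) atBot (𝓝 p) ∧ Tendsto (Φ.toFun y) atTop (𝓝 q)

/-- Pairs of points such that the second one is reached from the first one while dissipating
energy at most `N`. -/
def reachable (N : ℝ) : Set (X × X) :=
  {p | ∃ t, 0 ≤ t ∧ Φ.energy p.1 t ≤ N ∧ Φ.toFun p.1 t = p.2}

/-- The first exit of a trajectory from an open set. -/
theorem exists_first_exit {B : Set X} (hB : IsOpen B) {x : X} (hx : x ∈ B) {s : ℝ} (hs : 0 ≤ s)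
    (hsB : Φ.toFun x s ∉ B) :
    ∃ σ, 0 ≤ σ ∧ σ ≤ s ∧ Φ.toFun x σ ∈ closure B \ B ∧
      ∀ r ∈ Icc 0 σ, Φ.toFun x r ∈ closure B := by
  let A : Set ℝ := {r | 0 ≤ r ∧ Φ.toFun x r ∉ B}
  have hA : IsClosed A :=
    isClosed_Ici.inter (hB.isClosed_compl.preimage (Φ.continuous_trajectory x))
  have hbdd : BddBelow A := ⟨0, fun r hr ↦ hr.1⟩
  have hσ : sInf A ∈ A := hA.csInf_mem ⟨s, hs, hsB⟩ hbdd
  have hlt : ∀ r ∈ Ico 0 (sInf A), Φ.toFun x r ∈ B := fun r hr ↦ by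
    by_contra h
    exact absurd (csInf_le hbdd (⟨hr.1, h⟩ : r ∈ A)) (not_le.2 hr.2)
  have hpos : sInf A ≠ 0 := fun h ↦ by
    have := hσ.2
    rw [h, Φ.map_zero] at this
    exact this hx
  have hcl : Φ.toFun x (sInf A) ∈ closure B := by
    have h1 : sInf A ∈ closure (Ico 0 (sInf A)) := by
      rw [closure_Ico hpos.symm]; exact right_mem_Icc.2 hσ.1
    exact map_mem_closure (Φ.continuous_trajectory x) h1 hlt
  refine ⟨sInf A, hσ.1, csInf_le hbdd ⟨hs, hsB⟩, ⟨hcl, hσ.2⟩, fun r hr ↦ ?_⟩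
  rcases hr.2.eq_or_lt with h | h
  · rw [h]; exact hcl
  · exact subset_closure (hlt r ⟨hr.1, h⟩)

/-- Let pieces of trajectories start closer and closer to the rest point `q`, leave the
neighbourhood `B` of `q`, end closer and closer to the rest point `p`, and dissipate energy at
most `N`. The points where they leave `B` accumulate at a point `y`. The trajectory of `y` comes
from `q` and goes to a rest point `q'`, and the rest of the pieces leads from near `q'` to
near `p`. -/
theorem exists_connects_of_exit [T2Space X] {N : ℝ} {p q : X} (hp : p ∈ Φ.zeros)
    (hq : q ∈ Φ.zeros) {B : Set X} (hB : IsOpen B) (hqB : q ∈ B) (hcB : IsCompact (closure B))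
    (hZB : closure B ∩ Φ.zeros ⊆ {q})
    (hexit : ∀ O ∈ 𝓝 q, ∀ O' ∈ 𝓝 p, ∃ x ∈ O, ∃ t, 0 ≤ t ∧ Φ.energy x t ≤ N ∧
      Φ.toFun x t ∈ O' ∧ ∃ s ∈ Icc 0 t, Φ.toFun x s ∉ B) :
    ∃ q', Φ.Connects q q' ∧ (q', p) ∈ closure (Φ.reachable N) := by
  -- Triples of a starting point, the first exit time from `B`, and the final time.
  let S : Set (X × ℝ × ℝ) := {a | 0 ≤ a.2.1 ∧ a.2.1 ≤ a.2.2 ∧ Φ.energy a.1 a.2.2 ≤ N ∧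
    Φ.toFun a.1 a.2.1 ∈ closure B \ B ∧ ∀ r ∈ Icc 0 a.2.1, Φ.toFun a.1 r ∈ closure B}
  let ends : X × ℝ × ℝ → X × X := fun a ↦ (a.1, Φ.toFun a.1 a.2.2)
  have hne : (comap ends (𝓝 (q, p)) ⊓ 𝓟 S).NeBot := by
    rw [inf_principal_neBot_iff]
    intro V hV
    obtain ⟨V', hV', hVV⟩ := mem_comap.1 hV
    obtain ⟨O, hO, O', hO', hOO⟩ := mem_nhds_prod_iff.1 hV'
    obtain ⟨x, hx, t, ht, hN, hxt, s, hs, hsB⟩ :=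
      hexit (O ∩ B) (inter_mem hO (hB.mem_nhds hqB)) O' hO'
    obtain ⟨σ, hσ0, hσs, hσB, hσr⟩ := Φ.exists_first_exit hB hx.2 hs.1 hsB
    exact ⟨(x, σ, t), hVV (hOO (⟨hx.1, hxt⟩ : (x, Φ.toFun x t) ∈ O ×ˢ O')),
      hσ0, hσs.trans hs.2, hN, hσB, hσr⟩
  let u := Ultrafilter.of (comap ends (𝓝 (q, p)) ⊓ 𝓟 S)
  have hu := Ultrafilter.of_le (comap ends (𝓝 (q, p)) ⊓ 𝓟 S)
  have huS : ∀ᶠ a in (u : Filter (X × ℝ × ℝ)), a ∈ S :=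
    hu (mem_inf_of_right (mem_principal_self S))
  have huends : Tendsto ends u (𝓝 (q, p)) := tendsto_comap.mono_left (hu.trans inf_le_left)
  have hux : Tendsto (fun a : X × ℝ × ℝ ↦ a.1) u (𝓝 q) := huends.fst_nhds
  have hut : Tendsto (fun a : X × ℝ × ℝ ↦ Φ.toFun a.1 a.2.2) u (𝓝 p) := huends.snd_nhds
  obtain ⟨y, hyF, hy⟩ := (hcB.diff hB).ultrafilter_le_nhds
    (u.map fun a ↦ Φ.toFun a.1 a.2.1) (by
      rw [le_principal_iff]
      exact huS.mono fun a ha ↦ ha.2.2.2.1)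
  have huy : Tendsto (fun a : X × ℝ × ℝ ↦ Φ.toFun a.1 a.2.1) u (𝓝 y) := hy
  have hyZ : y ∉ Φ.zeros := fun h ↦ by
    have : y = q := hZB ⟨hyF.1, h⟩
    exact hyF.2 (this ▸ hqB)
  have hflow : ∀ s, Tendsto (fun a : X × ℝ × ℝ ↦ Φ.toFun a.1 (a.2.1 + s)) u (𝓝 (Φ.toFun y s)) := by
    intro s
    have h1 := ((Φ.continuous_toFun.tendsto (y, s)).comp (huy.prodMk_nhds tendsto_const_nhds))
    refine h1.congr fun a ↦ ?_
    exact Φ.map_add _ _ _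
  -- The exit times tend to infinity since `q` is fixed.
  have hσ : ∀ M, 0 ≤ M → ∀ᶠ a in (u : Filter (X × ℝ × ℝ)), M < a.2.1 := by
    intro M hM
    obtain ⟨v, v', hv, -, hqv, hMv, hvv⟩ := generalized_tube_lemma (isCompact_singleton (x := q))
      (isCompact_Icc (a := (0 : ℝ)) (b := M)) (hB.preimage Φ.continuous_toFun) (by
        rintro ⟨z, s⟩ ⟨hz, -⟩
        have hz' : z = q := hz
        subst hz'
        change Φ.toFun z s ∈ B
        rw [Φ.fixed z s hq]; exact hqB)
    filter_upwards [huS, hux (hv.mem_nhds (hqv rfl))] with a ha hav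
    by_contra! hcon
    exact ha.2.2.2.1.2 (hvv (⟨hav, hMv ⟨ha.1, hcon⟩⟩ : (a.1, a.2.1) ∈ v ×ˢ v'))
  -- So do the remaining times, since otherwise `y` would flow to `p` in finite time.
  have hτ : ∀ M, 0 ≤ M → ∀ᶠ a in (u : Filter (X × ℝ × ℝ)), M < a.2.2 - a.2.1 := by
    intro M hM
    by_contra hcon
    have h1 : ∀ᶠ a in (u : Filter (X × ℝ × ℝ)), a.2.2 - a.2.1 ∈ Icc 0 M := by
      filter_upwards [Ultrafilter.eventually_not.2 hcon, huS] with a ha haS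
      exact ⟨sub_nonneg.2 haS.2.1, not_lt.1 ha⟩
    obtain ⟨τ, -, hτ⟩ := (isCompact_Icc (a := (0 : ℝ)) (b := M)).ultrafilter_le_nhds
      (u.map fun a : X × ℝ × ℝ ↦ a.2.2 - a.2.1) (le_principal_iff.2 h1)
    have huτ : Tendsto (fun a : X × ℝ × ℝ ↦ a.2.2 - a.2.1) u (𝓝 τ) := hτ
    have h2 := (Φ.continuous_toFun.tendsto (y, τ)).comp (huy.prodMk_nhds huτ)
    have h3 : Tendsto (fun a : X × ℝ × ℝ ↦ Φ.toFun a.1 a.2.2) u (𝓝 (Φ.toFun y τ)) := by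
      refine h2.congr fun a ↦ ?_
      change Φ.toFun (Φ.toFun a.1 a.2.1) (a.2.2 - a.2.1) = _
      rw [Φ.map_add, add_sub_cancel]
    have h4 : Φ.toFun y τ = p := tendsto_nhds_unique h3 hut
    exact hyZ (Φ.mem_zeros_of_toFun_mem (t := τ) (h4 ▸ hp))
  have henergy : ∀ s, Tendsto (fun a : X × ℝ × ℝ ↦ Φ.energy a.1 (a.2.1 + s) - Φ.energy a.1 a.2.1)
      u (𝓝 (Φ.energy y s)) := by
    intro s
    have h1 := ((Φ.continuous_energy.tendsto (y, s)).comp (huy.prodMk_nhds tendsto_const_nhds))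
    refine h1.congr fun a ↦ ?_
    rw [Φ.energy_add, add_sub_cancel_left]
    rfl
  have hnonneg : ∀ x : X, ∀ t, 0 ≤ t → 0 ≤ Φ.energy x t := fun x t ht ↦ by
    have := Φ.energy_mono x ht
    rwa [Φ.energy_zero] at this
  have hback : ∀ s, 0 ≤ s → -Φ.energy y (-s) ≤ N := by
    intro s hs
    refine le_of_tendsto (henergy (-s)).neg ?_
    filter_upwards [hσ s hs, huS] with a ha haS
    have h1 := hnonneg a.1 (a.2.1 + -s) (by linarith)
    have h2 := Φ.energy_mono a.1 haS.2.1
    linarith [haS.2.2.1]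
  have hforth : ∀ s, 0 ≤ s → Φ.energy y s ≤ N := by
    intro s hs
    refine le_of_tendsto (henergy s) ?_
    filter_upwards [hτ s hs, huS] with a ha haS
    have h1 := hnonneg a.1 a.2.1 haS.1
    have h2 := Φ.energy_mono a.1 (show a.2.1 + s ≤ a.2.2 by linarith)
    linarith [haS.2.2.1]
  obtain ⟨z, hz, hyz⟩ := Φ.exists_tendsto_atBot hback
  obtain ⟨q', hq', hyq'⟩ := Φ.exists_tendsto_atTop hforth
  have hzq : z = q := by
    refine hZB ⟨isClosed_closure.mem_of_tendsto hyz ?_, hz⟩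
    filter_upwards [eventually_le_atBot 0] with s hs
    refine isClosed_closure.mem_of_tendsto (hflow s) ?_
    filter_upwards [hσ (-s) (by linarith), huS] with a ha haS
    exact haS.2.2.2.2 _ ⟨by linarith, by linarith⟩
  refine ⟨q', ⟨hq, hq', y, hyZ, hzq ▸ hyz, hyq'⟩, ?_⟩
  refine isClosed_closure.mem_of_tendsto (hyq'.prodMk_nhds tendsto_const_nhds) ?_
  filter_upwards [eventually_ge_atTop 0] with s hs
  refine mem_closure_of_tendsto ((hflow s).prodMk_nhds hut) ?_
  filter_upwards [hτ s hs, huS] with a ha haS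
  refine ⟨a.2.2 - (a.2.1 + s), by linarith, ?_, ?_⟩
  · have h1 := Φ.energy_add a.1 (a.2.1 + s) (a.2.2 - (a.2.1 + s))
    rw [add_sub_cancel] at h1
    have h2 := hnonneg a.1 (a.2.1 + s) (by linarith [haS.1])
    linarith [haS.2.2.1]
  · change Φ.toFun (Φ.toFun a.1 (a.2.1 + s)) _ = Φ.toFun a.1 a.2.2
    rw [Φ.map_add, add_sub_cancel]

/-- Every point has arbitrarily small neighbourhoods with compact closure containing no
other rest point. -/
theorem exists_isolating [T2Space X] [LocallyCompactSpace X] {q : X} {O : Set X}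
    (hO : O ∈ 𝓝 q) :
    ∃ B ⊆ O, IsOpen B ∧ q ∈ B ∧ IsCompact (closure B) ∧ closure B ∩ Φ.zeros ⊆ {q} := by
  have hfin : (Φ.zeros \ {q}).Finite := Φ.finite_zeros.subset sdiff_subset
  obtain ⟨B, hB, hqB, hBU, hcB⟩ := exists_open_between_and_isCompact_closure
    (isCompact_singleton (x := q)) (isOpen_interior.inter hfin.isClosed.isOpen_compl)
    (U := interior O ∩ (Φ.zeros \ {q})ᶜ)
    (singleton_subset_iff.2 ⟨mem_interior_iff_mem_nhds.2 hO, fun h ↦ h.2 rfl⟩)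
  refine ⟨B, subset_closure.trans (hBU.trans (inter_subset_left.trans interior_subset)), hB,
    hqB rfl, hcB, fun z hz ↦ ?_⟩
  by_contra h
  exact (hBU hz.1).2 ⟨hz.2, h⟩

/-- If there is no homoclinic cycle, then trajectories that start and end sufficiently close to a
rest point `p`, and dissipate energy at most `N`, stay near `p`. Otherwise they would accumulate at
a broken trajectory that starts at `p`. It has to end, since there are only finitely many rest
points, and it can only end at `p`. -/
theorem exists_nhds_forall_mem [T2Space X] [LocallyCompactSpace X]
    (hcycle : ∀ p, ¬ Relation.TransGen Φ.Connects p p) {p : X} (hp : p ∈ Φ.zeros) {O : Set X}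
    (hO : O ∈ 𝓝 p) (N : ℝ) :
    ∃ W, IsOpen W ∧ p ∈ W ∧ ∀ x ∈ W, ∀ t, 0 ≤ t → Φ.energy x t ≤ N → Φ.toFun x t ∈ W →
      ∀ s ∈ Icc 0 t, Φ.toFun x s ∈ O := by
  have hwf : WellFounded fun a b : Φ.zeros ↦ Relation.TransGen Φ.Connects b.1 a.1 := by
    have : Finite Φ.zeros := Φ.finite_zeros
    have : IsTrans Φ.zeros fun a b ↦ Relation.TransGen Φ.Connects b.1 a.1 :=
      ⟨fun a b c hab hbc ↦ hbc.trans hab⟩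
    have : Std.Irrefl fun a b : Φ.zeros ↦ Relation.TransGen Φ.Connects b.1 a.1 :=
      ⟨fun a ↦ hcycle a.1⟩
    exact Finite.wellFounded_of_trans_of_irrefl _
  have hreach : ∀ q : Φ.zeros, (q.1, p) ∈ closure (Φ.reachable N) →
      Relation.ReflTransGen Φ.Connects q.1 p := by
    intro q
    induction q using hwf.induction with
    | _ q ih =>
      intro hqp
      by_cases hne : q.1 = p
      · rw [hne]
      obtain ⟨B, -, hB, hqB, hcB, hZB⟩ := Φ.exists_isolating (univ_mem (f := 𝓝 q.1))
      have hpB : p ∉ closure B := fun h ↦ hne (hZB ⟨h, hp⟩ : p = q.1).symm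
      obtain ⟨q', hqq', hq'⟩ := Φ.exists_connects_of_exit hp q.2 hB hqB hcB hZB (N := N) (by
        intro O₁ hO₁ O₂ hO₂
        obtain ⟨⟨x, z⟩, ⟨hx, hz⟩, t, ht, hN, hxt⟩ := mem_closure_iff_nhds.1 hqp
          (O₁ ×ˢ (O₂ ∩ (closure B)ᶜ))
          (prod_mem_nhds hO₁ (inter_mem hO₂ (isClosed_closure.isOpen_compl.mem_nhds hpB)))
        simp only at hxt hx hz hN
        subst hxt
        exact ⟨x, hx, t, ht, hN, hz.1, t, right_mem_Icc.2 ht, fun h ↦ hz.2 (subset_closure h)⟩)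
      exact Relation.ReflTransGen.head hqq' (ih ⟨q', hqq'.2.1⟩ (.single hqq') hq')
  obtain ⟨B, hBO, hB, hpB, hcB, hZB⟩ := Φ.exists_isolating hO
  by_contra! hcon
  obtain ⟨q', hpq', hq'⟩ := Φ.exists_connects_of_exit hp hp hB hpB hcB hZB (N := N) (by
    intro O₁ hO₁ O₂ hO₂
    obtain ⟨W, hW, hWo, hpW⟩ := mem_nhds_iff.1 (inter_mem hO₁ hO₂)
    obtain ⟨x, hx, t, ht, hN, hxt, s, hs, hsO⟩ := hcon W hWo hpW
    exact ⟨x, (hW hx).1, t, ht, hN, (hW hxt).2, s, hs, fun h ↦ hsO (hBO h)⟩)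
  exact hcycle p (Relation.TransGen.head' hpq' (hreach ⟨q', hpq'.2.1⟩ hq'))

end DissipativeFlow

/-- A closed chain of related points can be indexed cyclically. -/
theorem Relation.TransGen.exists_chain {X : Type*} {r : X → X → Prop} {a b : X}
    (h : Relation.TransGen r a b) :
    ∃ (m : ℕ) (p : ℕ → X), p 0 = a ∧ p (m + 1) = b ∧ ∀ i ≤ m, r (p i) (p (i + 1)) := by
  induction h using Relation.TransGen.head_induction_on with
  | @single a h => exact ⟨0, fun i ↦ if i = 0 then a else b, by simp, by simp, by simpa using h⟩
  | @head a c h _ ih =>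
    obtain ⟨m, p, h0, hm, hp⟩ := ih
    refine ⟨m + 1, fun i ↦ if i = 0 then a else p (i - 1), by simp, by simpa using hm,
      fun i hi ↦ ?_⟩
    cases i with
    | zero => simpa [h0] using h
    | succ i => simpa using hp i (by omega)

/-! ### Null-homotopic sets -/

theorem exists_nhds_nullhomotopicIn {E : Type*} [NormedAddCommGroup E] [NormedSpace ℝ E]
    {X : Type*} [TopologicalSpace X] [ChartedSpace E X] (p : X) : ∃ B ∈ 𝓝 p, NullhomotopicIn B := by
  let e := chartAt E p
  have hp : p ∈ e.source := mem_chart_source E p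
  obtain ⟨r, hr, hball⟩ := Metric.isOpen_iff.1 e.open_target (e p) (e.map_source hp)
  refine ⟨e.source ∩ e ⁻¹' Metric.ball (e p) r, inter_mem (e.open_source.mem_nhds hp)
    ((e.continuousAt hp).preimage_mem_nhds (Metric.ball_mem_nhds _ hr)), ?_⟩
  let g : C(↥(e.source ∩ e ⁻¹' Metric.ball (e p) r), Metric.ball (e p) r) :=
    ⟨fun x ↦ ⟨e x.1, x.2.2⟩, ((e.continuousOn.mono inter_subset_left).domRestrict).subtype_mk _⟩
  let k : C(Metric.ball (e p) r, X) :=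
    ⟨fun z ↦ e.symm z.1, (e.continuousOn_symm.mono hball).domRestrict⟩
  have : ContractibleSpace (Metric.ball (e p) r) :=
    (convex_ball (e p) r).contractibleSpace ⟨e p, Metric.mem_ball_self hr⟩
  have h1 : (k.comp ((ContinuousMap.id _).comp g)).Nullhomotopic :=
    ((id_nullhomotopic _).comp_left g).comp_right k
  have h2 : k.comp ((ContinuousMap.id _).comp g) = ⟨Subtype.val, continuous_subtype_val⟩ := by
    ext x
    exact e.left_inv x.2.1
  rw [h2] at h1
  exact h1

/-- A set that can be deformed in `X` into a null-homotopic set is null-homotopic. -/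
theorem NullhomotopicIn.of_homotopy {X : Type*} [TopologicalSpace X] {U B : Set X}
    (hB : NullhomotopicIn B) (F : U × ℝ → X) (hF : Continuous F) (h0 : ∀ x, F (x, 0) = x)
    (h1 : ∀ x, F (x, 1) ∈ B) : NullhomotopicIn U := by
  let g : C(U, B) := ⟨fun x ↦ ⟨F (x, 1), h1 x⟩, (hF.comp (Continuous.prodMk_left 1)).subtype_mk _⟩
  obtain ⟨y, hy⟩ := hB.comp_left g
  refine ⟨y, ContinuousMap.Homotopic.trans ⟨?_⟩ hy⟩
  exact
    { toFun := fun a ↦ F (a.2, a.1)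
      continuous_toFun :=
        hF.comp (continuous_snd.prodMk (continuous_subtype_val.comp continuous_fst))
      map_zero_left := fun x ↦ h0 x
      map_one_left := fun x ↦ rfl }

namespace DissipativeFlow

variable {X : Type w}

/-- In the absence of homoclinic cycles, the points which flow to the rest point `p` while
dissipating energy at most `N` are contained in a null-homotopic open set. The times at which a
trajectory visits a small neighbourhood of `p` need not form an interval, but their convex hull
consists of times at which the trajectory is in a null-homotopic neighbourhood `B` of `p`. So a
partition of unity yields a continuous choice of such times. -/
theorem exists_nullhomotopic_open [EMetricSpace X] [LocallyCompactSpace X] (Φ : DissipativeFlow X)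
    (hcycle : ∀ p, ¬ Relation.TransGen Φ.Connects p p) {p : X} (hp : p ∈ Φ.zeros) {B : Set X}
    (hB : B ∈ 𝓝 p) (hBnull : NullhomotopicIn B) (N : ℝ) :
    ∃ V : Set X, IsOpen V ∧ NullhomotopicIn V ∧
      ∀ x, (∀ t, 0 ≤ t → Φ.energy x t ≤ N) → Tendsto (Φ.toFun x) atTop (𝓝 p) → x ∈ V := by
  obtain ⟨W, hW, hpW, hWB⟩ := Φ.exists_nhds_forall_mem hcycle hp hB (N + 1)
  let A : X → Set ℝ := fun x ↦ {t | 0 ≤ t ∧ Φ.toFun x t ∈ W ∧ Φ.energy x t < N + 1}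
  have hAopen : ∀ t, IsOpen {x | t ∈ A x} := fun t ↦ by
    refine isOpen_const.inter (IsOpen.inter ?_ ?_)
    · exact hW.preimage (Φ.continuous_toFun.comp (Continuous.prodMk_left t))
    · exact isOpen_Iio.preimage (Φ.continuous_energy.comp (Continuous.prodMk_left t))
  let V : Set X := ⋃ t, {x | t ∈ A x}
  have hVopen : IsOpen V := isOpen_iUnion hAopen
  have hconv : ∀ x, ∀ t ∈ convexHull ℝ (A x), Φ.toFun x t ∈ B := by
    intro x t ht
    obtain ⟨a, ha, hat⟩ : ∃ a ∈ A x, a ≤ t := by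
      by_contra! hcon
      exact lt_irrefl t (convexHull_min (fun a ha ↦ hcon a ha) (convex_Ioi t) ht)
    obtain ⟨b, hb, htb⟩ : ∃ b ∈ A x, t ≤ b := by
      by_contra! hcon
      exact lt_irrefl t (convexHull_min (fun a ha ↦ hcon a ha) (convex_Iio t) ht)
    have h1 := Φ.energy_add x a (b - a)
    rw [add_sub_cancel] at h1
    have h2 := Φ.energy_mono x ha.1
    rw [Φ.energy_zero] at h2
    have h3 := hWB _ ha.2.1 (b - a) (by linarith) (by linarith [hb.2.2])
      (by rw [Φ.map_add, add_sub_cancel]; exact hb.2.1) (t - a) ⟨by linarith, by linarith⟩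
    rwa [Φ.map_add, add_sub_cancel] at h3
  obtain ⟨τ, hτ⟩ := exists_continuous_forall_mem_convex_of_local_const
    (t := fun x : V ↦ convexHull ℝ (A x)) (fun x ↦ convex_convexHull ℝ _) (fun x ↦ by
      obtain ⟨t, ht⟩ := mem_iUnion.1 x.2
      refine ⟨t, ?_⟩
      filter_upwards [((hAopen t).preimage continuous_subtype_val).mem_nhds ht] with y hy
      exact subset_convexHull ℝ _ hy)
  refine ⟨V, hVopen, hBnull.of_homotopy (fun a ↦ Φ.toFun a.1 (a.2 * τ a.1)) ?_ ?_ ?_, ?_⟩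
  · exact Φ.continuous_toFun.comp ((continuous_subtype_val.comp continuous_fst).prodMk
      (continuous_snd.mul (τ.continuous.comp continuous_fst)))
  · intro x; rw [zero_mul, Φ.map_zero]
  · intro x; rw [one_mul]; exact hconv _ _ (hτ x)
  · intro x hx hlim
    obtain ⟨t, ht, h0⟩ := ((hlim.eventually (hW.mem_nhds hpW)).and (eventually_ge_atTop 0)).exists
    exact mem_iUnion.2 ⟨t, h0, ht, (hx t h0).trans_lt (lt_add_one N)⟩

/-! ### The time at which a given energy is dissipated -/

/-- Away from the rest points, energy is dissipated at a positive rate. -/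
theorem energy_strictMono [TopologicalSpace X] (Φ : DissipativeFlow X) {x : X} (hx : x ∉ Φ.zeros) :
    StrictMono (Φ.energy x) := by
  intro s t hst
  have h1 := Φ.energy_sub x s t
  have h2 : 0 < ∫ r in s..t, Φ.rate (Φ.toFun x r) :=
    intervalIntegral.intervalIntegral_pos_of_pos (Φ.intervalIntegrable_rate x s t)
      (fun r ↦ lt_of_le_of_ne (Φ.rate_nonneg _) fun h ↦ hx (Φ.mem_zeros_of_toFun_mem h.symm)) hst
  linarith

theorem hasDerivAt_energy [TopologicalSpace X] (Φ : DissipativeFlow X) (x : X) (t : ℝ) :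
    HasDerivAt (Φ.energy x) (Φ.rate (Φ.toFun x t)) t :=
  intervalIntegral.integral_hasDerivAt_right (Φ.intervalIntegrable_rate x 0 t)
    (Φ.continuous_rate_trajectory x).aestronglyMeasurable.stronglyMeasurableAtFilter
    (Φ.continuous_rate_trajectory x).continuousAt

/-- The time at which a trajectory has dissipated the energy `N` depends smoothly on its starting
point, by the implicit function theorem. -/
theorem exists_contMDiffOn_time {E : Type u} [NormedAddCommGroup E] [NormedSpace ℝ E]
    [FiniteDimensional ℝ E] [TopologicalSpace X] [ChartedSpace E X] [IsManifold 𝓘(ℝ, E) ∞ X]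
    (Φ : DissipativeFlow X)
    (hsmooth : ContMDiff (𝓘(ℝ, E).prod 𝓘(ℝ, ℝ)) 𝓘(ℝ, ℝ) ∞ fun p : X × ℝ ↦ Φ.energy p.1 p.2)
    {N : ℝ} (hN : 0 < N) :
    ∃ T : X → ℝ, ContMDiffOn 𝓘(ℝ, E) 𝓘(ℝ, ℝ) ∞ T {x | ∃ t, 0 ≤ t ∧ N < Φ.energy x t} ∧
      ∀ x, (∃ t, 0 ≤ t ∧ N < Φ.energy x t) → Φ.energy x (T x) = N := by
  have hex : ∀ x, ∃ s, (∃ t, 0 ≤ t ∧ N < Φ.energy x t) → Φ.energy x s = N := by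
    intro x
    by_cases h : ∃ t, 0 ≤ t ∧ N < Φ.energy x t
    · obtain ⟨t, ht, hNt⟩ := h
      have hc : Continuous (Φ.energy x) := Φ.continuous_energy.comp (Continuous.prodMk_right x)
      obtain ⟨s, -, hs⟩ := intermediate_value_Icc ht hc.continuousOn
        (⟨by rw [Φ.energy_zero]; exact hN.le, hNt.le⟩ : N ∈ Icc (Φ.energy x 0) (Φ.energy x t))
      exact ⟨s, fun _ ↦ hs⟩
    · exact ⟨0, fun h' ↦ absurd h' h⟩
  choose T hT using hex
  refine ⟨T, fun x₀ hx₀ ↦ ContMDiffAt.contMDiffWithinAt ?_, hT⟩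
  let e := extChartAt 𝓘(ℝ, E) x₀
  have hx₀Z : x₀ ∉ Φ.zeros := fun h ↦ by
    obtain ⟨t, ht, hNt⟩ := hx₀
    have h1 : Φ.energy x₀ t = 0 := by
      have h2 : ∀ s, Φ.rate (Φ.toFun x₀ s) = 0 := fun s ↦ by rw [Φ.fixed x₀ s h]; exact h
      simp only [energy, h2, intervalIntegral.integral_zero]
    linarith
  let F : E × ℝ → ℝ := fun q ↦ Φ.energy (e.symm q.1) q.2
  let q₀ : E × ℝ := (e x₀, T x₀)
  have hex₀ : e.symm (e x₀) = x₀ := e.left_inv (mem_extChartAt_source x₀)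
  have hF : ContDiffAt ℝ ∞ F q₀ := by
    rw [← contMDiffAt_iff_contDiffAt]
    have h1 : ContMDiffAt 𝓘(ℝ, E × ℝ) 𝓘(ℝ, E) ∞ (fun q : E × ℝ ↦ e.symm q.1) q₀ :=
      ContMDiffAt.comp q₀ (g := e.symm) (I' := 𝓘(ℝ, E))
        ((contMDiffOn_extChartAt_symm x₀).contMDiffAt
          (extChartAt_target_mem_nhds (I := 𝓘(ℝ, E)) x₀))
        contDiff_fst.contMDiff.contMDiffAt
    have h2 : ContMDiffAt 𝓘(ℝ, E × ℝ) 𝓘(ℝ, ℝ) ∞ (fun q : E × ℝ ↦ q.2) q₀ :=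
      contDiff_snd.contMDiff.contMDiffAt
    exact ContMDiffAt.comp q₀ hsmooth.contMDiffAt (h1.prodMk h2)
  have hne : (∞ : WithTop ℕ∞) ≠ 0 := by simp
  have hderiv : HasFDerivAt (fun t ↦ F (e x₀, t)) (fderiv ℝ F q₀ ∘L .inr ℝ E ℝ) (T x₀) :=
    HasFDerivAt.comp (g := F) (T x₀) ((hF.differentiableAt hne).hasFDerivAt)
      (hasFDerivAt_prodMk_right (e x₀) (T x₀))
  have hderiv' : HasDerivAt (fun t ↦ F (e x₀, t)) (Φ.rate (Φ.toFun x₀ (T x₀))) (T x₀) := by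
    simp only [F, hex₀]
    exact Φ.hasDerivAt_energy x₀ (T x₀)
  have hrate : Φ.rate (Φ.toFun x₀ (T x₀)) ≠ 0 := fun h ↦ hx₀Z (Φ.mem_zeros_of_toFun_mem h)
  have hinv : (fderiv ℝ F q₀ ∘L .inr ℝ E ℝ).IsInvertible := by
    rw [hderiv.unique hderiv'.hasFDerivAt]
    exact ⟨ContinuousLinearEquiv.unitsEquivAut ℝ (Units.mk0 _ hrate), by ext; simp⟩
  have hφ := hF.contDiffAt_implicitFunction hne hinv
  have hφe := hF.eventually_apply_implicitFunction hne hinv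
  set φ := hF.implicitFunction hne hinv
  have h1 : ContMDiffAt 𝓘(ℝ, E) 𝓘(ℝ, ℝ) ∞ (fun x ↦ φ (e x)) x₀ :=
    ContMDiffAt.comp x₀ (g := φ) (I' := 𝓘(ℝ, E)) hφ.contMDiffAt contMDiffAt_extChartAt
  refine h1.congr_of_eventuallyEq ?_
  have hZ : ∀ᶠ x in 𝓝 x₀, x ∉ Φ.zeros := Φ.isClosed_zeros.isOpen_compl.mem_nhds hx₀Z
  obtain ⟨t, ht, hNt⟩ := hx₀
  have hU : ∀ᶠ x in 𝓝 x₀, N < Φ.energy x t :=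
    ((Φ.continuous_energy.comp (Continuous.prodMk_left t)).tendsto x₀).eventually
      (lt_mem_nhds hNt)
  filter_upwards [hZ, hU, (continuousAt_extChartAt (I := 𝓘(ℝ, E)) x₀).eventually hφe,
    extChartAt_source_mem_nhds (I := 𝓘(ℝ, E)) x₀] with x hxZ hxt hxφ hxs
  refine (Φ.energy_strictMono hxZ).injective ?_
  rw [hT x ⟨t, ht, hxt⟩]
  have h2 : F q₀ = N := by
    simp only [F, q₀, hex₀]
    exact hT x₀ ⟨t, ht, hNt⟩
  rw [h2] at hxφ
  have h3 : e.symm (extChartAt 𝓘(ℝ, E) x₀ x) = x := e.left_inv hxs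
  simp only [F, h3] at hxφ
  exact hxφ.symm

end DissipativeFlow

/-! ### The gradient flow of a form -/

section GradientFlow

variable {E : Type u} [NormedAddCommGroup E] [NormedSpace ℝ E] [FiniteDimensional ℝ E]
  {X : Type w} [TopologicalSpace X] [ChartedSpace E X]
  [Bundle.RiemannianBundle (fun x : X ↦ TangentSpace 𝓘(ℝ, E) x)]

theorem apply_formGrad_nonneg (α : (x : X) → (TangentSpace 𝓘(ℝ, E) x →L[ℝ] ℝ)) (x : X) :
    0 ≤ α x (formGrad α x) := by
  rw [← inner_formGrad]; exact real_inner_self_nonneg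

theorem apply_formGrad_eq_norm_sq (α : (x : X) → (TangentSpace 𝓘(ℝ, E) x →L[ℝ] ℝ)) (x : X) :
    α x (formGrad α x) = ‖formGrad α x‖ ^ 2 := by
  rw [← inner_formGrad, real_inner_self_eq_norm_sq]

theorem formGrad_eq_zero_iff {α : (x : X) → (TangentSpace 𝓘(ℝ, E) x →L[ℝ] ℝ)} {x : X} :
    formGrad α x = 0 ↔ α x = 0 := by
  constructor
  · intro h
    ext v
    rw [← inner_formGrad, h, inner_zero_left]; rfl
  · intro h
    have h1 := apply_formGrad_eq_norm_sq α x
    rw [h] at h1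
    have h2 : ‖formGrad α x‖ ^ 2 = 0 := h1.symm
    exact norm_eq_zero.1 (pow_eq_zero_iff two_ne_zero |>.1 h2)

theorem apply_formGrad_eq_zero_iff {α : (x : X) → (TangentSpace 𝓘(ℝ, E) x →L[ℝ] ℝ)} {x : X} :
    α x (formGrad α x) = 0 ↔ α x = 0 := by
  rw [apply_formGrad_eq_norm_sq, pow_eq_zero_iff two_ne_zero, norm_eq_zero, formGrad_eq_zero_iff]

theorem contMDiff_apply_formGrad [IsManifold 𝓘(ℝ, E) ∞ X]
    [IsContMDiffRiemannianBundle 𝓘(ℝ, E) ∞ E (fun x : X ↦ TangentSpace 𝓘(ℝ, E) x)]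
    {α : (x : X) → (TangentSpace 𝓘(ℝ, E) x →L[ℝ] ℝ)} (hα : IsSmoothOneForm α) :
    ContMDiff 𝓘(ℝ, E) 𝓘(ℝ, ℝ) ∞ fun x ↦ α x (formGrad α x) := by
  intro x
  have h := ContMDiffAt.clm_bundle_apply (F₂ := ℝ) (E₂ := Bundle.Trivial X ℝ) (hα x)
    (contMDiff_formGrad hα x)
  rw [Bundle.contMDiffAt_totalSpace] at h
  exact h.2

/-- The flow of `-grad α`, given by a family of integral curves, dissipates energy at the rate
`α(grad α) = |grad α|²`. -/
def gradientFlow [IsManifold 𝓘(ℝ, E) ∞ X] [T2Space X]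
    [IsContMDiffRiemannianBundle 𝓘(ℝ, E) ∞ E (fun x : X ↦ TangentSpace 𝓘(ℝ, E) x)]
    (α : (x : X) → (TangentSpace 𝓘(ℝ, E) x →L[ℝ] ℝ)) (hα : IsSmoothOneForm α)
    (hfin : (zerosOfForm α).Finite)
    (hbound : ∃ c : ℝ, 0 < c ∧ ∃ U : Set X, IsCompact U ∧ ∀ x, x ∉ U → c ≤ ‖formGrad α x‖)
    (ψ : X → ℝ → X) (h0 : ∀ x, ψ x 0 = x)
    (hψ : ∀ x, IsMIntegralCurve (I := 𝓘(ℝ, E)) (ψ x) (fun x ↦ -formGrad α x)) :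
    DissipativeFlow X where
  toFun := ψ
  rate x := α x (formGrad α x)
  continuous_toFun := (contMDiff_flow_integral (contMDiff_formGrad hα).neg_section
    (contMDiff_apply_formGrad hα) h0 hψ).1.continuous
  map_zero := h0
  map_add := integralCurve_add (contMDiff_formGrad hα).neg_section h0 hψ
  continuous_rate := (contMDiff_apply_formGrad hα).continuous
  rate_nonneg := apply_formGrad_nonneg α
  finite_zeros := by
    refine hfin.subset fun x hx ↦ ?_
    exact apply_formGrad_eq_zero_iff.1 hx
  fixed x t hx := by
    have : IsManifold 𝓘(ℝ, E) 1 X := IsManifold.of_le (n := ∞) (by simp)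
    have hv : -formGrad α x = 0 := by
      rw [formGrad_eq_zero_iff.2 (apply_formGrad_eq_zero_iff.1 hx), neg_zero]
    have h1 := isMIntegralCurve_Ioo_eq_of_contMDiff_boundaryless (t₀ := 0)
      ((contMDiff_formGrad hα).neg_section.of_le (by simp)) (hψ x)
      (isMIntegralCurve_const (v := fun x ↦ -formGrad α x) hv) (h0 x)
    exact congrFun h1 t
  bound := by
    obtain ⟨c, hc, U, hU, hcU⟩ := hbound
    refine ⟨c ^ 2, by positivity, U, hU, fun x hx ↦ ?_⟩
    rw [apply_formGrad_eq_norm_sq]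
    gcongr
    exact hcU x hx

/-- Flowing along `-grad α` for the time `T x` decreases the integral of `α` by the dissipated
energy. -/
theorem lineIntegral_flow {α : (x : X) → (TangentSpace 𝓘(ℝ, E) x →L[ℝ] ℝ)} {γ : ℝ → X}
    (hγ : IsMIntegralCurve (I := 𝓘(ℝ, E)) γ (fun x ↦ -formGrad α x)) (T : ℝ) :
    lineIntegral α (fun t ↦ γ (t * T)) = -∫ s in (0 : ℝ)..T, α (γ s) (formGrad α (γ s)) := by
  have h1 : ∀ t ∈ uIcc (0 : ℝ) 1, α (γ (t * T))
      (mfderivWithin 𝓘(ℝ, ℝ) 𝓘(ℝ, E) (fun t ↦ γ (t * T)) (Icc 0 1) t (1 : ℝ)) =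
      -(T * α (γ (t * T)) (formGrad α (γ (t * T)))) := by
    intro t ht
    rw [uIcc_of_le zero_le_one] at ht
    have h2 := (hγ.comp_mul T t).hasMFDerivWithinAt (s := Icc 0 1)
    have h3 : UniqueMDiffWithinAt 𝓘(ℝ, ℝ) (Icc (0 : ℝ) 1) t :=
      uniqueMDiffWithinAt_iff_uniqueDiffWithinAt.2 (uniqueDiffOn_Icc zero_lt_one t ht)
    have h4 := h2.mfderivWithin h3
    have h5 : mfderivWithin 𝓘(ℝ, ℝ) 𝓘(ℝ, E) (fun t ↦ γ (t * T)) (Icc 0 1) t (1 : ℝ) =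
        T • -formGrad α (γ (t * T)) := by
      refine (DFunLike.congr_fun h4 (1 : ℝ)).trans ?_
      exact one_smul ℝ _
    rw [h5, map_smul, map_neg, smul_eq_mul, mul_neg]
  rw [lineIntegral, intervalIntegral.integral_congr h1, intervalIntegral.integral_neg,
    intervalIntegral.integral_const_mul]
  have h6 := intervalIntegral.mul_integral_comp_mul_right (a := 0) (b := 1)
    (f := fun s ↦ α (γ s) (formGrad α (γ s))) T
  rw [zero_mul, one_mul] at h6
  exact congrArg Neg.neg h6

/-- A cycle of connections between rest points of the gradient flow is a homoclinic cycle. -/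
theorem hasHomoclinicCycle_of_transGen [IsManifold 𝓘(ℝ, E) ∞ X] [T2Space X]
    [IsContMDiffRiemannianBundle 𝓘(ℝ, E) ∞ E (fun x : X ↦ TangentSpace 𝓘(ℝ, E) x)]
    {α : (x : X) → (TangentSpace 𝓘(ℝ, E) x →L[ℝ] ℝ)} (hα : IsSmoothOneForm α)
    (hfin : (zerosOfForm α).Finite)
    (hbound : ∃ c : ℝ, 0 < c ∧ ∃ U : Set X, IsCompact U ∧ ∀ x, x ∉ U → c ≤ ‖formGrad α x‖)
    {ψ : X → ℝ → X} (h0 : ∀ x, ψ x 0 = x)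
    (hψ : ∀ x, IsMIntegralCurve (I := 𝓘(ℝ, E)) (ψ x) (fun x ↦ -formGrad α x)) {p : X}
    (hp : Relation.TransGen (gradientFlow α hα hfin hbound ψ h0 hψ).Connects p p) :
    HasHomoclinicCycle (fun x ↦ -formGrad α x) := by
  obtain ⟨m, P, hP0, hPm, hP⟩ := hp.exists_chain
  have hP' : ∀ i : Fin (m + 1), (gradientFlow α hα hfin hbound ψ h0 hψ).Connects (P i)
      (P (i + 1 : Fin (m + 1))) := by
    intro i
    have h1 := hP i (Nat.lt_succ_iff.1 i.2)
    rcases (Nat.lt_succ_iff.1 i.2).lt_or_eq with h | h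
    · rwa [Fin.val_add_one_of_lt (by rw [Fin.lt_def]; exact h)]
    · have h2 : i = Fin.last m := Fin.ext h
      subst h2
      rw [Fin.last_add_one, Fin.val_zero, hP0, ← hPm]
      exact h1
  choose h1 h2 y hy hbot htop using hP'
  refine ⟨m, fun i ↦ P i, fun i ↦ ψ (y i), fun i ↦ ?_, fun i ↦ ⟨hψ _, ?_, hbot i, htop i⟩⟩
  · change -formGrad α (P i) = 0
    rw [formGrad_eq_zero_iff.2 (apply_formGrad_eq_zero_iff.1 (h1 i)), neg_zero]
  · by_contra! hconst
    have h3 : Tendsto (ψ (y i)) atTop (𝓝 (y i)) :=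
      tendsto_const_nhds.congr fun t ↦ by rw [hconst t 0, h0]
    exact hy i (tendsto_nhds_unique h3 (htop i) ▸ h2 i)

end GradientFlow

/-- In the absence of homoclinic cycles, the points that dissipate more energy than `N` are moved
along the flow until the integral of `α` is `-N`. All others converge to a rest point `p`, and for
each `p` they are contained in a null-homotopic open set. -/
theorem hasCategoricalCovers_of_forall_not_transGen
    {E : Type u} [NormedAddCommGroup E] [NormedSpace ℝ E] [FiniteDimensional ℝ E]
    {X : Type w} [EMetricSpace X] [ChartedSpace E X] [IsManifold 𝓘(ℝ, E) ∞ X]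
    [Bundle.RiemannianBundle (fun x : X ↦ TangentSpace 𝓘(ℝ, E) x)]
    [IsContMDiffRiemannianBundle 𝓘(ℝ, E) ∞ E (fun x : X ↦ TangentSpace 𝓘(ℝ, E) x)]
    {α : (x : X) → (TangentSpace 𝓘(ℝ, E) x →L[ℝ] ℝ)} (hα : IsSmoothOneForm α)
    (hfin : (zerosOfForm α).Finite)
    (hbound : ∃ c : ℝ, 0 < c ∧ ∃ U : Set X, IsCompact U ∧ ∀ x, x ∉ U → c ≤ ‖formGrad α x‖)
    {ψ : X → ℝ → X} (h0 : ∀ x, ψ x 0 = x)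
    (hψ : ∀ x, IsMIntegralCurve (I := 𝓘(ℝ, E)) (ψ x) (fun x ↦ -formGrad α x))
    (hcycle : ∀ p, ¬ Relation.TransGen (gradientFlow α hα hfin hbound ψ h0 hψ).Connects p p) :
    HasCategoricalCovers α (zerosOfForm α).ncard := by
  have hloc : LocallyCompactSpace X := Manifold.locallyCompact_of_finiteDimensional 𝓘(ℝ, E)
  let Φ := gradientFlow α hα hfin hbound ψ h0 hψ
  have hΦ : Φ.zeros = zerosOfForm α := Set.ext fun x ↦ apply_formGrad_eq_zero_iff
  have hsmooth := contMDiff_flow_integral (contMDiff_formGrad hα).neg_section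
    (contMDiff_apply_formGrad hα) h0 hψ
  rw [← hΦ]
  intro N hN
  have hN' : (0 : ℝ) < N := Nat.cast_pos.2 hN
  have hballs : ∀ p : Φ.zeros, ∃ V : Set X, IsOpen V ∧ NullhomotopicIn V ∧
      ∀ x, (∀ t, 0 ≤ t → Φ.energy x t ≤ N) → Tendsto (Φ.toFun x) atTop (𝓝 p.1) → x ∈ V := by
    intro p
    obtain ⟨B, hB, hBnull⟩ := exists_nhds_nullhomotopicIn (E := E) p.1
    exact Φ.exists_nullhomotopic_open hcycle p.2 hB hBnull N
  choose V hV hVnull hVmem using hballs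
  have : Finite Φ.zeros := Φ.finite_zeros
  let e := Finite.equivFin Φ.zeros
  let U : Set X := {x | ∃ t, 0 ≤ t ∧ (N : ℝ) < Φ.energy x t}
  have hU : IsOpen U := by
    have h1 : U = ⋃ t ∈ Ici (0 : ℝ), {x | (N : ℝ) < Φ.energy x t} := by
      ext x; simp [U]
    rw [h1]
    exact isOpen_biUnion fun t _ ↦
      isOpen_Ioi.preimage (Φ.continuous_energy.comp (Continuous.prodMk_left t))
  refine ⟨U, fun i ↦ V (e.symm i), hU, fun i ↦ hV _, ?_, fun i ↦ hVnull _, ?_⟩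
  · refine eq_univ_of_forall fun x ↦ ?_
    by_cases hx : x ∈ U
    · exact Or.inl hx
    · have hx' : ∀ t, 0 ≤ t → Φ.energy x t ≤ N := fun t ht ↦ not_lt.1 fun h ↦ hx ⟨t, ht, h⟩
      obtain ⟨z, hz, hlim⟩ := Φ.exists_tendsto_atTop hx'
      refine Or.inr (mem_iUnion.2 ⟨e ⟨z, hz⟩, ?_⟩)
      rw [e.symm_apply_apply]
      exact hVmem ⟨z, hz⟩ x hx' hlim
  · obtain ⟨T, hTsmooth, hT⟩ := Φ.exists_contMDiffOn_time hsmooth.2 hN'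
    refine ⟨fun a ↦ ψ a.1 (a.2 * T a.1), ?_, fun x _ ↦ ?_, fun x hx ↦ ?_⟩
    · have h1 : ContMDiffOn (𝓘(ℝ, E).prod 𝓘(ℝ, ℝ)) 𝓘(ℝ, ℝ) ∞ (fun a : X × ℝ ↦ T a.1)
          (U ×ˢ Icc (0 : ℝ) 1) :=
        hTsmooth.comp contMDiffOn_fst fun a ha ↦ ha.1
      have h2 : ContMDiffOn (𝓘(ℝ, E).prod 𝓘(ℝ, ℝ)) 𝓘(ℝ, ℝ) ∞ (fun a : X × ℝ ↦ a.2 * T a.1)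
          (U ×ˢ Icc (0 : ℝ) 1) :=
        contMDiffOn_snd.smul h1
      exact ContMDiff.comp_contMDiffOn (g := fun p : X × ℝ ↦ ψ p.1 p.2)
        (f := fun a : X × ℝ ↦ (a.1, a.2 * T a.1)) hsmooth.1 (contMDiffOn_fst.prodMk h2)
    · simp only [zero_mul, h0]
    · refine (lineIntegral_flow (hψ x) (T x)).trans_le ?_
      exact neg_le_neg (hT x hx).ge

end

theorem mainTheorem1
    {E : Type*} [NormedAddCommGroup E] [NormedSpace ℝ E] [FiniteDimensional ℝ E]
    {X : Type*} [EMetricSpace X] [ChartedSpace E X] [IsManifold 𝓘(ℝ, E) ∞ X]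
    [Bundle.RiemannianBundle (fun x : X ↦ TangentSpace 𝓘(ℝ, E) x)]
    [IsContMDiffRiemannianBundle 𝓘(ℝ, E) ∞ E (fun x : X ↦ TangentSpace 𝓘(ℝ, E) x)]
    [IsRiemannianManifold 𝓘(ℝ, E) X] [CompleteSpace X]
    (α : (x : X) → (TangentSpace 𝓘(ℝ, E) x →L[ℝ] ℝ)) (hα : IsClosedOneForm α)
    (hzeros : (zerosOfForm α).encard < lsCat α)
    (hcomplete : IsCompleteVectorField (fun x ↦ formGrad α x))
    (hbound : ∃ c : ℝ, 0 < c ∧ ∃ U : Set X, IsCompact U ∧ U ∈ 𝓝ˢ (zerosOfForm α) ∧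
      ∀ x, x ∉ U → c ≤ ‖formGrad α x‖) :
    HasHomoclinicCycle (fun x ↦ -formGrad α x) := by
  have hfin : (zerosOfForm α).Finite := Set.encard_lt_top_iff.1 (hzeros.trans_le le_top)
  have hcurves : ∀ x : X, ∃ γ : ℝ → X, γ 0 = x ∧
      IsMIntegralCurve (I := 𝓘(ℝ, E)) γ (fun x ↦ -formGrad α x) := by
    intro x
    obtain ⟨γ, h0, hγ⟩ := hcomplete x
    refine ⟨γ ∘ (· * (-1)), by simp [h0], ?_⟩
    have h1 := hγ.comp_mul (-1)
    have h2 : (-1 : ℝ) • (fun x ↦ formGrad α x) = fun x ↦ -formGrad α x := by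
      funext x; simp
    rwa [h2] at h1
  choose ψ h0 hψ using hcurves
  obtain ⟨c, hc, U, hU, -, hcU⟩ := hbound
  by_contra hno
  have hcat : HasCategoricalCovers α (zerosOfForm α).ncard :=
    hasCategoricalCovers_of_forall_not_transGen hα.smooth hfin ⟨c, hc, U, hU, hcU⟩ h0 hψ
      fun p hp ↦ hno (hasHomoclinicCycle_of_transGen hα.smooth hfin ⟨c, hc, U, hU, hcU⟩ h0 hψ hp)
  rw [← hfin.cast_ncard_eq] at hzeros
  exact absurd hzeros (not_lt.2 (iInf₂_le _ hcat))
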